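/- Let $n\ge 0$ be an integer. An $n\times n$ alternating sign matrix (ASM) is a matrix $B=(b_{i,j})$ with entries in $\{0,1,-1\}$ whose row sums and column sums are all $1$ and whose partial row sums $\sum_{j\le k} b_{i,j}$ and partial column sums $\sum_{i\le k} b_{i,j}$ all lie in $\{0,1\}$. Let $$\mathrm{Inv}(B)=\sum_{i<j,\ k<\ell} b_{i,\ell}\,b_{j,k},$$ let $N(B)$ be the number of entries of $B$ equal to $-1$, and let $t(B)$ be the number of $0$ entries to the left of the unique $1$ in the top row of $B$ (with $t(B)=0$ if $n=0$). For every ASM $B$ one has $\mathrm{Inv}(B)\ge N(B)$. A descending plane partition (DPP) is a finite, possibly empty, array of positive integers $a_{i,j}$, $1\le i\le r$, $i\le j\le \mu_i$, with $\mu_i\ge i$ and $\mu_1\ge\mu_2\ge\cdots\ge\mu_r$, such that, with $\lambda_i=\mu_i-i+1$ and $\lambda_0=\infty$, $$a_{i,j}\ge a_{i,j+1},\qquad a_{i,j}>a_{i+1,j},\qquad \lambda_i<a_{i,i}\le\lambda_{i-1}$$ whenever the entries involved are defined. It is of order $n$ if all its parts satisfy $a_{i,j}\le n$. A part $a_{i,j}$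 is special if $a_{i,j}\le j-i$. Let $S(A)$ and $NS(A)$ be the numbers of special and of non-special parts of $A$, and, for $A$ of order $n$, let $M(A)$ be the number of parts equal to $n$. Then, for every $n$, as polynomials in $x,y,z$ with integer coefficients (equivalently, for all elements $x,y,z$ of every commutative ring), $$\sum_{B\ n\times n\ \mathrm{ASM}} z^{t(B)}\,y^{\mathrm{Inv}(B)-N(B)}\,x^{N(B)}\;=\;\sum_{A\ \mathrm{DPP\ of\ order}\ n} x^{S(A)}\,y^{NS(A)}\,z^{M(A)} .$$ -/

import Mathlib

namespace ASMDPP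

/-! ### Alternating sign matrices -/

/-- Alternating sign matrices: entries in `{0, 1, -1}`, all row and column sums equal to `1`, and
all partial row and column sums (from the left, from the top) equal to `0` or `1`. Equivalently,
the nonzero entries of each row and column alternate in sign and sum to `1`. -/
structure IsASM {n : ℕ} (B : Matrix (Fin n) (Fin n) ℤ) : Prop where
  entry : ∀ i j, B i j = 0 ∨ B i j = 1 ∨ B i j = -1
  col_partial : ∀ k j, 0 ≤ ∑ i ∈ Finset.Iic k, B i j ∧ ∑ i ∈ Finset.Iic k, B i j ≤ 1
  row_partial : ∀ i k, 0 ≤ ∑ j ∈ Finset.Iic k, B i j ∧ ∑ j ∈ Finset.Iic k, B i j ≤ 1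
  col_sum : ∀ j, ∑ i, B i j = 1
  row_sum : ∀ i, ∑ j, B i j = 1

/-- The inversion number `∑_{i < j, k < l} b_{i,l} b_{j,k}`. -/
def inv {n : ℕ} (B : Matrix (Fin n) (Fin n) ℤ) : ℤ :=
  ∑ i, ∑ j ∈ Finset.Ioi i, ∑ k, ∑ l ∈ Finset.Ioi k, B i l * B j k

/-- The number of entries equal to `-1`. -/
def numNeg {n : ℕ} (B : Matrix (Fin n) (Fin n) ℤ) : ℕ :=
  (Finset.univ.filter fun p : Fin n × Fin n => B p.1 p.2 = -1).card

/-- The number of columns `j` such that the top row has a `0` in column `j` and a `1` somewhere to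
the right of it. In an alternating sign matrix the top row has a single `1`, so that this is the
number of zeros to the left of it. -/
def topZeros {n : ℕ} (B : Matrix (Fin n) (Fin n) ℤ) : ℕ :=
  (Finset.univ.filter fun j : Fin n =>
    B ⟨0, j.pos⟩ j = 0 ∧ ∃ l : Fin n, j < l ∧ B ⟨0, j.pos⟩ l = 1).card

theorem finite_asm (n : ℕ) : {B : Matrix (Fin n) (Fin n) ℤ | IsASM B}.Finite := by
  have h : {f : Fin n → Fin n → ℤ | ∀ i, f i ∈ {g : Fin n → ℤ | ∀ j, g j ∈
      ({0, 1, -1} : Set ℤ)}}.Finite :=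
    Set.Finite.pi' fun _ => Set.Finite.pi' fun _ => Set.toFinite _
  refine h.subset fun B hB => ?_
  intro i j
  exact hB.entry i j

theorem sum_Iic_eq {n : ℕ} (f : Fin n → ℤ) (k : Fin n) :
    ∑ i ∈ Finset.Iic k, f i = ∑ i ∈ Finset.Iio k, f i + f k := by
  rw [← Finset.Iio_insert, Finset.sum_insert (by simp), add_comm]

theorem sum_Iio_nonneg {n : ℕ} (f : Fin n → ℤ)
    (h : ∀ k, 0 ≤ ∑ i ∈ Finset.Iic k, f i) (k : Fin n) : 0 ≤ ∑ i ∈ Finset.Iio k, f i := by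
  rcases Nat.eq_zero_or_pos k.val with h0 | h0
  · have : Finset.Iio k = ∅ := by
      ext i
      simp only [Finset.mem_Iio, Finset.notMem_empty, iff_false, not_lt, Fin.le_def]
      omega
    simp [this]
  · have : Finset.Iio k = Finset.Iic (⟨k.val - 1, by omega⟩ : Fin n) := by
      ext i
      simp only [Finset.mem_Iio, Finset.mem_Iic, Fin.lt_def, Fin.le_def]
      omega
    rw [this]
    exact h _

theorem inv_eq {n : ℕ} (B : Matrix (Fin n) (Fin n) ℤ) :
    inv B = ∑ p : Fin n × Fin n,
      (∑ i ∈ Finset.Iio p.1, B i p.2) * ∑ k ∈ Finset.Iio p.2, B p.1 k := by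
  have h1 : inv B = ∑ i, ∑ j ∈ Finset.Ioi i, ∑ l, ∑ k ∈ Finset.Iio l, B i l * B j k := by
    unfold inv
    refine Finset.sum_congr rfl fun i _ => Finset.sum_congr rfl fun j _ => ?_
    exact Finset.sum_comm' (by simp)
  have h2 : inv B = ∑ j, ∑ i ∈ Finset.Iio j, ∑ l, ∑ k ∈ Finset.Iio l, B i l * B j k := by
    rw [h1]
    exact Finset.sum_comm' (by simp)
  rw [h2, Fintype.sum_prod_type]
  refine Finset.sum_congr rfl fun j _ => ?_
  rw [Finset.sum_comm]
  refine Finset.sum_congr rfl fun l _ => ?_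
  rw [Finset.sum_mul_sum]

/-- The exponent `Inv(B) - N(B)` is nonnegative. -/
theorem numNeg_le_inv {n : ℕ} {B : Matrix (Fin n) (Fin n) ℤ} (hB : IsASM B) :
    (numNeg B : ℤ) ≤ inv B := by
  rw [inv_eq, numNeg, Finset.card_filter, Nat.cast_sum]
  refine Finset.sum_le_sum fun p _ => ?_
  have hc := sum_Iio_nonneg (fun i => B i p.2) (fun k => (hB.col_partial k p.2).1) p.1
  have hr := sum_Iio_nonneg (fun j => B p.1 j) (fun k => (hB.row_partial p.1 k).1) p.2
  have hc1 := (hB.col_partial p.1 p.2).1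
  have hr1 := (hB.row_partial p.1 p.2).1
  rw [sum_Iic_eq (fun i => B i p.2)] at hc1
  rw [sum_Iic_eq (fun j => B p.1 j)] at hr1
  split_ifs with h
  · rw [h] at hc1 hr1
    push_cast
    nlinarith
  · push_cast
    positivity

/-- The weight `z^{t(B)} y^{Inv(B) - N(B)} x^{N(B)}`; by `numNeg_le_inv` the exponent of `y` is not
truncated when `B` is an alternating sign matrix. -/
def asmWeight {R : Type*} [CommRing R] (x y z : R) {n : ℕ} (B : Matrix (Fin n) (Fin n) ℤ) : R :=
  z ^ topZeros B * y ^ (inv B - (numNeg B : ℤ)).toNat * x ^ numNeg B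

/-- The generating function of the `n × n` alternating sign matrices. -/
noncomputable def asmZ {R : Type*} [CommRing R] (n : ℕ) (x y z : R) : R :=
  ∑ B ∈ (finite_asm n).toFinset, asmWeight x y z B

/-! ### Descending plane partitions

A shifted array is the list of its rows, each row being the list of its parts. Row and position
indices start at `0`: position `m` of row `i` holds the part usually written
`a_{i+1, i+1+m}`. -/

/-- The number of parts in row `i`, usually written `λ_{i+1}`. -/
def rowLen (A : List (List ℕ)) (i : ℕ) : ℕ := (A.getD i []).length

/-- The last column occupied by row `i`, usually written `μ_{i+1} = λ_{i+1} + i`. -/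
def rowEnd (A : List (List ℕ)) (i : ℕ) : ℕ := rowLen A i + i

/-- The part at position `m` of row `i`, usually written `a_{i+1, i+1+m}`
(only used for `m < rowLen A i`). -/
def part (A : List (List ℕ)) (i m : ℕ) : ℕ := (A.getD i []).getD m 0

/-- Descending plane partitions. The part below position `m + 1` of row `i` is at position `m` of
row `i + 1`. -/
structure IsDPP (A : List (List ℕ)) : Prop where
  row_nonempty : ∀ i < A.length, 0 < rowLen A i
  part_pos : ∀ i < A.length, ∀ m < rowLen A i, 0 < part A i m
  rowEnd_le : ∀ i, i + 1 < A.length → rowEnd A (i + 1) ≤ rowEnd A i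
  row_le : ∀ i < A.length, ∀ m, m + 1 < rowLen A i → part A i (m + 1) ≤ part A i m
  col_lt : ∀ i, i + 1 < A.length → ∀ m < rowLen A (i + 1), part A (i + 1) m < part A i (m + 1)
  rowLen_lt : ∀ i < A.length, rowLen A i < part A i 0
  le_rowLen : ∀ i, i + 1 < A.length → part A (i + 1) 0 ≤ rowLen A i

/-- All parts are at most `n`. -/
def HasOrder (n : ℕ) (A : List (List ℕ)) : Prop :=
  ∀ i < A.length, ∀ m < rowLen A i, part A i m ≤ n

/-- The number of special parts, that is, `a_{i,j} ≤ j - i`. -/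
def numSpecial (A : List (List ℕ)) : ℕ :=
  ∑ i ∈ Finset.range A.length, ((Finset.range (rowLen A i)).filter fun m => part A i m ≤ m).card

/-- The number of non-special parts. -/
def numNonspecial (A : List (List ℕ)) : ℕ :=
  ∑ i ∈ Finset.range A.length, ((Finset.range (rowLen A i)).filter fun m => ¬ part A i m ≤ m).card

/-- The number of parts equal to `n`. -/
def numMax (n : ℕ) (A : List (List ℕ)) : ℕ :=
  ∑ i ∈ Finset.range A.length, ((Finset.range (rowLen A i)).filter fun m => part A i m = n).card

theorem finite_lists {α : Type*} {s : Set α} (hs : s.Finite) (n : ℕ) :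
    {l : List α | l.length ≤ n ∧ ∀ a ∈ l, a ∈ s}.Finite := by
  have := hs.to_subtype
  refine ((List.finite_length_le s n).image (List.map Subtype.val)).subset ?_
  rintro l ⟨hl, hm⟩
  exact ⟨l.attach.map fun a => ⟨a.1, hm a.1 a.2⟩, by simpa using hl, by simp⟩

theorem rowEnd_le_order {n : ℕ} {A : List (List ℕ)} (hA : IsDPP A) (hn : HasOrder n A) :
    ∀ i < A.length, rowEnd A i ≤ n := by
  intro i
  induction i with
  | zero =>
    intro h
    have h1 := hA.rowLen_lt 0 h
    have h2 := hn 0 h 0 (hA.row_nonempty 0 h)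
    simp only [rowEnd]
    omega
  | succ i ih =>
    intro h
    exact (hA.rowEnd_le i h).trans (ih (by omega))

theorem finite_dpp (n : ℕ) : {A : List (List ℕ) | IsDPP A ∧ HasOrder n A}.Finite := by
  refine (finite_lists (finite_lists (Set.finite_Iic n) n) n).subset ?_
  rintro A ⟨hA, hn⟩
  have hle := rowEnd_le_order hA hn
  refine ⟨?_, fun row hrow => ?_⟩
  · by_contra! h
    have h1 := hle n h
    have h2 := hA.row_nonempty n h
    simp only [rowEnd] at h1
    omega
  · obtain ⟨i, hi, rfl⟩ := List.mem_iff_getElem.1 hrow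
    have hlen : rowLen A i = A[i].length := by simp [rowLen, hi]
    have h1 := hle i hi
    refine ⟨by simp only [rowEnd] at h1; omega, fun a ha => ?_⟩
    obtain ⟨m, hm, rfl⟩ := List.mem_iff_getElem.1 ha
    have h2 := hn i hi m (by omega)
    simpa [part, hi, hm] using h2

/-- The weight `x^{S(A)} y^{NS(A)} z^{M(A)}` of a descending plane partition of order `n`. -/
def dppWeight {R : Type*} [CommRing R] (x y z : R) (n : ℕ) (A : List (List ℕ)) : R :=
  x ^ numSpecial A * y ^ numNonspecial A * z ^ numMax n A

/-- The generating function of the descending plane partitions of order `n`. -/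
noncomputable def dppZ {R : Type*} [CommRing R] (n : ℕ) (x y z : R) : R :=
  ∑ A ∈ (finite_dpp n).toFinset, dppWeight x y z n A

end ASMDPP

/-! For n = N + 1 both generating functions equal one determinant: the matrix of the coefficients of
X^l in `pathSeries` at height m + 1, minus the shift matrix (up to transposition: `asmZ_eq_det`,
`dppZ_eq_det`).

Alternating sign matrices are the states of the six-vertex model with domain walls, the edge states
being partial row and column sums. The vertex weights depend on column parameters u and row
parameters s. With all u = 0 and s = (σ, 0, ..., 0), where z (1 - σ) = 1, the state sum is (1 - σ)^N
times the ASM generating function: the first row records t(B), the other rows only contribute x and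
y (`prod_vertexWeight_eq`). The Yang–Baxter equation makes the partition function symmetric in s,
and interpolation in one column parameter gives the Izergin–Korepin determinant (`dwbc_mul_eq_det`).
That formula is 0 = 0 when parameters coincide. Partial fractions split the factor depending on s
off the matrix, and polynomial remainders split off the factor depending on u; both Vandermonde
determinants then cancel, and the resulting identity `prod_mul_dwbc` holds in every commutative
ring. At the special parameters, row operations and removal of a common power series factor produce
the determinant.

For descending plane partitions, expanding along the shift gives a sum over subsets S of minors
(`det_sub_shift`). The set S records the row lengths, and the minor counts the arrays with these
lengths as families of nonintersecting paths (`sum_rowWeight_eq_det`). Instead of a sign-reversing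
involution, differences of adjacent columns remove the first part of every row at once and produce
the interlacing conditions between rows.

The determinant formulas are proved over a field, the first one for z ≠ 0. Applying them in the
fraction field of ℤ[x, y, z] and specializing gives every commutative ring. -/

namespace ASMDPP

open Finset

/-! ### The six-vertex model with domain wall boundary conditions -/

section SixVertex

variable {A : Type*} [CommRing A] (x y : A)

/-- Vertex weights of the six-vertex model with column parameter `u` and row parameter `s`;
the Booleans are the states of the left, top, right and bottom edges. -/
def vertexWeight (u s : A) : Bool → Bool → Bool → Bool → A
  | false, false, false, false => 1 - u * s
  | true, true, true, true => y * (1 - u * s)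
  | true, false, true, false => 1 - x * u - (1 + (y - x) * u) * s
  | false, true, false, true => 1 - x * u - (1 + (y - x) * u) * s
  | false, false, true, true => 1
  | true, true, false, false =>
      (1 + (y - x - 1) * u + x * u ^ 2) * (x + (y - x - 1) * s + s ^ 2)
  | _, _, _, _ => 0

/-- The row transfer matrix: the weight of a row with left state `h`, right state `k`, top states
`v` and bottom states `w`. -/
def rowTransfer (s : A) : {n : ℕ} → (Fin n → A) → Bool → Bool → (Fin n → Bool) → (Fin n → Bool) → A
  | 0, _, h, k, _, _ => if h = k then 1 else 0
  | _ + 1, u, h, k, v, w => ∑ g, vertexWeight x y (u 0) s h (v 0) g (w 0) *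
      rowTransfer s (Fin.tail u) g k (Fin.tail v) (Fin.tail w)

/-- The intertwiner of two rows. -/
def rMatrix (s t : A) : Bool → Bool → Bool → Bool → A
  | false, false, false, false => s * t + (y - x) * s - t + x
  | true, true, true, true => s * t + (y - x) * s - t + x
  | false, true, false, true => x + (y - x - 1) * s + s ^ 2
  | true, false, true, false => x + (y - x - 1) * t + t ^ 2
  | false, true, true, false => y * (s - t)
  | true, false, false, true => s - t
  | _, _, _, _ => 0

theorem sum_fin_succ_fun {ι M : Type*} [Fintype ι] [AddCommMonoid M] {n : ℕ}
    (F : (Fin (n + 1) → ι) → M) :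
    ∑ v, F v = ∑ b, ∑ v : Fin n → ι, F (Fin.cons b v) := by
  rw [← (Fin.consEquiv fun _ : Fin (n + 1) => ι).sum_comp, Fintype.sum_prod_type]
  rfl

/-- A finite check over 64 boundary states; it moves the intertwiner through one column and
exchanges the two row parameters. -/
theorem vertexWeight_yangBaxter (u s t : A) (h₁ h₂ k₁ k₂ v w : Bool) :
    ∑ g₁, ∑ g₂, rMatrix x y s t h₁ h₂ g₁ g₂ *
      ∑ m, vertexWeight x y u s g₁ v k₁ m * vertexWeight x y u t g₂ m k₂ w =
    ∑ g₁, ∑ g₂, (∑ m, vertexWeight x y u t h₁ v g₁ m * vertexWeight x y u s h₂ m g₂ w) *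
      rMatrix x y s t g₁ g₂ k₁ k₂ := by
  cases h₁ <;> cases h₂ <;> cases k₁ <;> cases k₂ <;> cases v <;> cases w <;>
    simp only [Fintype.sum_bool, rMatrix, vertexWeight, mul_zero, zero_mul, add_zero, zero_add] <;>
    ring

/-- The intertwiner passes through the columns one at a time: `key` splits off the first column,
`e1` crosses it, and the induction hypothesis `e2` crosses the rest. -/
theorem rowTransfer_yangBaxter (s t : A) {n : ℕ} (u : Fin n → A) (h₁ h₂ k₁ k₂ : Bool)
    (v w : Fin n → Bool) :
    ∑ g₁, ∑ g₂, rMatrix x y s t h₁ h₂ g₁ g₂ *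
      ∑ m, rowTransfer x y s u g₁ k₁ v m * rowTransfer x y t u g₂ k₂ m w =
    ∑ g₁, ∑ g₂, (∑ m, rowTransfer x y t u h₁ g₁ v m * rowTransfer x y s u h₂ g₂ m w) *
      rMatrix x y s t g₁ g₂ k₁ k₂ := by
  induction n generalizing h₁ h₂ k₁ k₂ with
  | zero =>
    simp only [rowTransfer, univ_unique, sum_singleton, Fintype.sum_bool]
    cases h₁ <;> cases h₂ <;> cases k₁ <;> cases k₂ <;> simp
  | succ n ih =>
    have key : ∀ (a b : A) (g₁ g₂ l₁ l₂ : Bool),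
        ∑ m, rowTransfer x y a u g₁ l₁ v m * rowTransfer x y b u g₂ l₂ m w =
        ∑ c₁, ∑ c₂, (∑ m, vertexWeight x y (u 0) a g₁ (v 0) c₁ m *
            vertexWeight x y (u 0) b g₂ m c₂ (w 0)) *
          ∑ m, rowTransfer x y a (Fin.tail u) c₁ l₁ (Fin.tail v) m *
            rowTransfer x y b (Fin.tail u) c₂ l₂ m (Fin.tail w) := by
      intro a b g₁ g₂ l₁ l₂
      rw [sum_fin_succ_fun]
      simp only [rowTransfer, Fin.cons_zero, Fin.tail_cons, Fintype.sum_bool, Finset.mul_sum,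
        ← Finset.sum_add_distrib]
      refine Finset.sum_congr rfl fun m _ => ?_
      ring
    simp only [key]
    have e1 : ∀ c₁ c₂, ∑ g₁, ∑ g₂, rMatrix x y s t h₁ h₂ g₁ g₂ *
        ∑ m, vertexWeight x y (u 0) s g₁ (v 0) c₁ m * vertexWeight x y (u 0) t g₂ m c₂ (w 0) =
        ∑ g₁, ∑ g₂, (∑ m, vertexWeight x y (u 0) t h₁ (v 0) g₁ m *
          vertexWeight x y (u 0) s h₂ m g₂ (w 0)) * rMatrix x y s t g₁ g₂ c₁ c₂ :=
      fun c₁ c₂ => vertexWeight_yangBaxter x y (u 0) s t h₁ h₂ c₁ c₂ (v 0) (w 0)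
    have e2 := fun c₁ c₂ => ih (Fin.tail u) c₁ c₂ k₁ k₂ (Fin.tail v) (Fin.tail w)
    generalize hP : (fun g₁ g₂ c₁ c₂ => ∑ m, vertexWeight x y (u 0) s g₁ (v 0) c₁ m *
      vertexWeight x y (u 0) t g₂ m c₂ (w 0)) = P
    generalize hP' : (fun g₁ g₂ c₁ c₂ => ∑ m, vertexWeight x y (u 0) t g₁ (v 0) c₁ m *
      vertexWeight x y (u 0) s g₂ m c₂ (w 0)) = P'
    generalize hT : (fun c₁ c₂ l₁ l₂ => ∑ m, rowTransfer x y s (Fin.tail u) c₁ l₁ (Fin.tail v) m *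
            rowTransfer x y t (Fin.tail u) c₂ l₂ m (Fin.tail w)) = Q
    generalize hT' : (fun c₁ c₂ l₁ l₂ => ∑ m, rowTransfer x y t (Fin.tail u) c₁ l₁ (Fin.tail v) m *
            rowTransfer x y s (Fin.tail u) c₂ l₂ m (Fin.tail w)) = Q'
    simp only [funext_iff] at hP hP' hT hT'
    simp only [hP, hP', hT, hT', Fintype.sum_bool] at e1 e2 ⊢
    calc _ = ∑ c₁, ∑ c₂, (∑ g₁, ∑ g₂, rMatrix x y s t h₁ h₂ g₁ g₂ * P g₁ g₂ c₁ c₂) *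
          Q c₁ c₂ k₁ k₂ := by simp only [Fintype.sum_bool]; ring
      _ = ∑ g₁, ∑ g₂, P' h₁ h₂ g₁ g₂ * ∑ c₁, ∑ c₂, rMatrix x y s t g₁ g₂ c₁ c₂ * Q c₁ c₂ k₁ k₂ := by
        simp only [Fintype.sum_bool, e1]; ring
      _ = _ := by simp only [Fintype.sum_bool, e2]; ring

/-- The transfer matrix of a row with left state `0` and right state `1`. -/
def rowOp (s : A) {n : ℕ} (u : Fin n → A) : Matrix (Fin n → Bool) (Fin n → Bool) A :=
  fun v w => rowTransfer x y s u false true v w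

/-- On the left states 0, 0 and on the right states 1, 1 the intertwiner acts by the same scalar,
which cancels because it is nonzero. -/
theorem rowOp_commute [IsDomain A] {s t : A} (hst : s * t + (y - x) * s - t + x ≠ 0) {n : ℕ}
    (u : Fin n → A) : Commute (rowOp x y s u) (rowOp x y t u) := by
  ext v w
  have h := rowTransfer_yangBaxter x y s t u false false true true v w
  simp only [Fintype.sum_bool, rMatrix, zero_mul, mul_zero, add_zero, zero_add] at h
  rw [mul_comm] at h
  exact mul_right_cancel₀ hst h

/-- The partition function with domain wall boundary conditions. -/
def dwbc {n : ℕ} (u : Fin n → A) (l : List A) : A :=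
  (l.map fun s => rowOp x y s u).prod (fun _ => false) (fun _ => true)

theorem dwbc_perm [IsDomain A] {n : ℕ} (u : Fin n → A) {l l' : List A} (h : l.Perm l')
    (hl : l.Pairwise fun s t => s * t + (y - x) * s - t + x ≠ 0) :
    dwbc x y u l = dwbc x y u l' := by
  unfold dwbc
  rw [(h.map fun s => rowOp x y s u).prod_eq' ?_]
  rw [List.pairwise_map]
  exact hl.imp fun h => rowOp_commute x y h u

end SixVertex

/-! ### The Izergin–Korepin determinant -/

section IzerginKorepin

/-- A function given by a polynomial of degree at most `d`. -/
def IsPolyFun {K : Type*} [CommRing K] (d : ℕ) (f : K → K) : Prop :=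
  ∃ p : Polynomial K, p.natDegree ≤ d ∧ ∀ t, p.eval t = f t

/-! ### Degree bounds for polynomial functions -/

namespace IsPolyFun

variable {K : Type*} [CommRing K]

theorem mono {d e : ℕ} {f : K → K} (h : IsPolyFun d f) (hde : d ≤ e) : IsPolyFun e f := by
  obtain ⟨p, hp, h⟩ := h
  exact ⟨p, hp.trans hde, h⟩

theorem const (c : K) : IsPolyFun 0 fun _ : K => c :=
  ⟨.C c, by simp, by simp⟩

theorem linear (a b : K) : IsPolyFun 1 fun t : K => a - b * t :=
  ⟨.C a - .C b * .X, by compute_degree, by simp⟩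

theorem mul {d e : ℕ} {f g : K → K} (hf : IsPolyFun d f) (hg : IsPolyFun e g) :
    IsPolyFun (d + e) fun t => f t * g t := by
  obtain ⟨p, hp, hf⟩ := hf
  obtain ⟨q, hq, hg⟩ := hg
  exact ⟨p * q, Polynomial.natDegree_mul_le.trans (by omega), by simp [hf, hg]⟩

theorem add {d : ℕ} {f g : K → K} (hf : IsPolyFun d f) (hg : IsPolyFun d g) :
    IsPolyFun d fun t => f t + g t := by
  obtain ⟨p, hp, hf⟩ := hf
  obtain ⟨q, hq, hg⟩ := hg
  exact ⟨p + q, Polynomial.natDegree_add_le_of_degree_le hp hq, by simp [hf, hg]⟩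

theorem sub {d : ℕ} {f g : K → K} (hf : IsPolyFun d f) (hg : IsPolyFun d g) :
    IsPolyFun d fun t => f t - g t := by
  obtain ⟨p, hp, hf⟩ := hf
  obtain ⟨q, hq, hg⟩ := hg
  exact ⟨p - q, (Polynomial.natDegree_sub_le p q).trans (by omega), by simp [hf, hg]⟩

theorem sum {ι : Type*} {d : ℕ} (s : Finset ι) {f : ι → K → K} (hf : ∀ i, IsPolyFun d (f i)) :
    IsPolyFun d fun t => ∑ i ∈ s, f i t := by
  choose p hp hf using hf
  exact ⟨∑ i ∈ s, p i, Polynomial.natDegree_sum_le_of_forall_le _ _ fun i _ => hp i,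
    by simp [Polynomial.eval_finsetSum, hf]⟩

theorem prod {ι : Type*} (d : ℕ) (s : Finset ι) {f : ι → K → K} (hf : ∀ i, IsPolyFun d (f i)) :
    IsPolyFun (d * #s) fun t => ∏ i ∈ s, f i t := by
  choose p hp hf using hf
  refine ⟨∏ i ∈ s, p i, (Polynomial.natDegree_prod_le _ _).trans ?_,
    by simp [Polynomial.eval_prod, hf]⟩
  exact (Finset.sum_le_card_nsmul _ _ d fun i _ => hp i).trans (by simp [mul_comm])

theorem list_prod {ι : Type*} (l : List ι) {f : ι → K → K} (hf : ∀ i, IsPolyFun 1 (f i)) :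
    IsPolyFun l.length fun t => (l.map fun i => f i t).prod := by
  induction l with
  | nil => simpa using const 1
  | cons a l ih =>
    simp only [List.map_cons, List.prod_cons, List.length_cons]
    exact ((hf a).mul ih).mono (by omega)

theorem eq_zero {K : Type*} [CommRing K] [IsDomain K] {d : ℕ} {f : K → K} (hf : IsPolyFun d f)
    (s : Finset K) (hs : d < #s) (h : ∀ t ∈ s, f t = 0) (t : K) : f t = 0 := by
  obtain ⟨p, hp, hf⟩ := hf
  rw [← hf, Polynomial.eq_zero_of_natDegree_lt_card_of_eval_eq_zero' p s
    (fun t ht => by rw [hf, h t ht]) (by omega), Polynomial.eval_zero]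

end IsPolyFun

/-! ### Dependence on the first column parameter, and the recursion at ts = 1 -/

section Ring

variable {A : Type*} [CommRing A] (x y : A)

/-- The weight of a straight crossing of edges in different states. -/
def weightB (u s : A) : A := 1 - x * u - (1 + (y - x) * u) * s

variable {n : ℕ} (u : Fin n → A) (s t : A) (v w : Fin n → Bool)

theorem rowOp_cons_false_false :
    rowOp x y s (Fin.cons t u : Fin (n + 1) → A) (Fin.cons false v) (Fin.cons false w) =
      (1 - t * s) * rowOp x y s u v w := by
  simp [rowOp, rowTransfer, vertexWeight]

theorem rowOp_cons_false_true :
    rowOp x y s (Fin.cons t u : Fin (n + 1) → A) (Fin.cons false v) (Fin.cons true w) =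
      rowTransfer x y s u true true v w := by
  simp [rowOp, rowTransfer, vertexWeight]

theorem rowOp_cons_true_false :
    rowOp x y s (Fin.cons t u : Fin (n + 1) → A) (Fin.cons true v) (Fin.cons false w) = 0 := by
  simp [rowOp, rowTransfer, vertexWeight]

theorem rowOp_cons_true_true :
    rowOp x y s (Fin.cons t u : Fin (n + 1) → A) (Fin.cons true v) (Fin.cons true w) =
      weightB x y t s * rowOp x y s u v w := by
  simp [rowOp, rowTransfer, vertexWeight, weightB]

theorem rowOp_prod_cons_true_true (l : List A) :
    (l.map fun s => rowOp x y s (Fin.cons t u : Fin (n + 1) → A)).prod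
      (Fin.cons true v) (Fin.cons true w) =
    (l.map fun s => weightB x y t s).prod * (l.map fun s => rowOp x y s u).prod v w := by
  induction l generalizing v with
  | nil => simp [Matrix.one_apply, Fin.cons_right_injective _ |>.eq_iff]
  | cons a l ih =>
    simp only [List.map_cons, List.prod_cons, Matrix.mul_apply]
    rw [sum_fin_succ_fun]
    simp only [Fintype.sum_bool, rowOp_cons_true_false, rowOp_cons_true_true, ih, zero_mul,
      sum_const_zero, add_zero, mul_sum]
    exact sum_congr rfl fun m _ => by ring

theorem rowOp_prod_cons_false_true (l : List A) :
    ((s :: l).map fun s => rowOp x y s (Fin.cons t u : Fin (n + 1) → A)).prod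
      (Fin.cons false v) (Fin.cons true w) =
    (∑ m, rowTransfer x y s u true true v m * ((l.map fun s => weightB x y t s).prod *
        (l.map fun s => rowOp x y s u).prod m w)) +
    (1 - t * s) * ∑ m, rowOp x y s u v m *
        (l.map fun s => rowOp x y s (Fin.cons t u : Fin (n + 1) → A)).prod
          (Fin.cons false m) (Fin.cons true w) := by
  simp only [List.map_cons, List.prod_cons, Matrix.mul_apply]
  rw [sum_fin_succ_fun]
  simp only [Fintype.sum_bool, rowOp_cons_false_false, rowOp_cons_false_true,
    rowOp_prod_cons_true_true, mul_sum, mul_assoc]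

/-- The edges of the first column switch from 0 to 1 in exactly one row, where the vertex has weight
1. Every other row contributes a factor linear in t, so the degree is one less than the number of
rows. The quadratic corner weight needs left state 1 and never occurs in this column. -/
theorem isPolyFun_rowOp_prod (l : List A) (d : ℕ) (hl : l.length ≤ d + 1) :
    IsPolyFun d fun t => (l.map fun s => rowOp x y s (Fin.cons t u : Fin (n + 1) → A)).prod
      (Fin.cons false v) (Fin.cons true w) := by
  induction l generalizing v d with
  | nil =>
    refine IsPolyFun.mono ?_ (Nat.zero_le d)
    convert IsPolyFun.const (0 : A) using 2
    rw [List.map_nil, List.prod_nil, Matrix.one_apply_ne]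
    intro h
    simpa using congrFun h 0
  | cons s l ih =>
    simp only [rowOp_prod_cons_false_true]
    refine IsPolyFun.add (IsPolyFun.sum _ fun m => ?_) ?_
    · refine ((IsPolyFun.const _).mul ((IsPolyFun.list_prod l fun s => ?_).mul
        (IsPolyFun.const _))).mono (d := 0 + (l.length + 0)) (by simpa using hl)
      convert IsPolyFun.linear (1 - s) (x + (y - x) * s) using 2
      unfold weightB
      ring
    · cases d with
      | zero =>
        obtain rfl : l = [] := by simpa using hl
        convert IsPolyFun.const (0 : A) using 2
        refine mul_eq_zero_of_right _ (sum_eq_zero fun m _ => ?_)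
        rw [List.map_nil, List.prod_nil, Matrix.one_apply_ne, mul_zero]
        intro h
        simpa using congrFun h 0
      | succ d =>
        refine IsPolyFun.mono (IsPolyFun.mul (d := 1) (e := d) ?_ (IsPolyFun.sum _ fun m => ?_))
          (by omega)
        · convert IsPolyFun.linear 1 s using 2
          ring
        · exact ((IsPolyFun.const _).mul (ih m d (by simpa using hl))).mono (by omega)

/-- Left state 1 and top state 0 allow only the straight crossing, so the whole row is frozen. -/
theorem rowTransfer_true_true_false :
    rowTransfer x y s u true true (fun _ => false) w =
      if w = fun _ => false then ∏ j, weightB x y (u j) s else 0 := by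
  induction n with
  | zero => simp [rowTransfer, Subsingleton.elim w fun _ => false]
  | succ n ih =>
    have h := ih (Fin.tail u) (Fin.tail w)
    have hw : (w = fun _ => false) ↔ w 0 = false ∧ Fin.tail w = fun _ => false := by
      simp only [funext_iff, Fin.forall_fin_succ, Fin.tail]
    have hf : (Fin.tail fun _ : Fin (n + 1) => false) = fun _ => false := rfl
    rw [rowTransfer, hf, Fin.prod_univ_succ]
    cases h0 : w 0
    · simp only [Fintype.sum_bool, vertexWeight, h, hw, h0, true_and, zero_mul, add_zero, mul_ite,
        mul_zero]
      rfl
    · simp [vertexWeight, hw, h0]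

theorem const_eq_cons (b : Bool) : (fun _ : Fin (n + 1) => b) = Fin.cons b fun _ => b := by
  ext i
  cases i using Fin.cases <;> rfl

/-- The weight 1 - ts of an empty vertex vanishes, so the first column must switch in the first row.
This freezes the first row and the first column and leaves a smaller domain wall problem. -/
theorem dwbc_cons_of_mul_eq_one (h : t * s = 1) (l : List A) :
    dwbc x y (Fin.cons t u : Fin (n + 1) → A) (s :: l) =
      (∏ j, weightB x y (u j) s) * (l.map fun s => weightB x y t s).prod * dwbc x y u l := by
  unfold dwbc
  rw [const_eq_cons, const_eq_cons, rowOp_prod_cons_false_true]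
  simp [h, rowTransfer_true_true_false, mul_assoc]

theorem isPolyFun_dwbc (l : List A) (d : ℕ) (hl : l.length ≤ d + 1) :
    IsPolyFun d fun t => dwbc x y (Fin.cons t u : Fin (n + 1) → A) l := by
  unfold dwbc
  rw [const_eq_cons, const_eq_cons]
  exact isPolyFun_rowOp_prod x y u _ _ l d hl

/-- The matrix of the Izergin–Korepin determinant, each column being multiplied by its common
denominator. -/
def ikMatrix (s : Fin n → A) : Matrix (Fin n) (Fin n) A :=
  .of fun i j => ∏ k ∈ univ.erase i, (1 - u j * s k) * weightB x y (u j) (s k)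

theorem ikMatrix_comp_perm (s : Fin n → A) (σ : Equiv.Perm (Fin n)) :
    ikMatrix x y u (s ∘ σ) = (ikMatrix x y u s).submatrix σ id := by
  ext i j
  simp only [ikMatrix, Matrix.of_apply, Matrix.submatrix_apply, id, Function.comp]
  exact prod_nbij' σ σ.symm (by simp) (by simp [Equiv.symm_apply_eq]) (by simp) (by simp) (by simp)

theorem det_vandermonde_cons (s : Fin n → A) :
    (Matrix.vandermonde (Fin.cons t s : Fin (n + 1) → A)).det =
      (∏ j, (s j - t)) * (Matrix.vandermonde s).det := by
  rw [Matrix.det_vandermonde, Matrix.det_vandermonde, Fin.prod_univ_succ, Fin.prod_Ioi_zero]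
  simp only [Fin.prod_Ioi_succ, Fin.cons_zero, Fin.cons_succ]

theorem erase_zero_univ : (univ.erase (0 : Fin (n + 1))) = univ.map (Fin.succEmb n) := by
  ext i
  cases i using Fin.cases <;> simp [Fin.succ_ne_zero]

theorem prod_erase_succ (F : Fin (n + 1) → A) (i : Fin n) :
    ∏ k ∈ univ.erase i.succ, F k = F 0 * ∏ k ∈ univ.erase i, F k.succ := by
  have : univ.erase i.succ = insert 0 ((univ.erase i).map (Fin.succEmb n)) := by
    ext k
    cases k using Fin.cases <;> simp [(Fin.succ_ne_zero _).symm]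
  rw [this, prod_insert (by simp), prod_map]
  rfl

/-- In the first column of the matrix every entry but the top one contains the factor 1 - t s₀ = 0,
so the determinant has the same recursion as the partition function. -/
theorem dwbc_mul_eq_det_of_mul_eq_one {s₀ : A} (s : Fin n → A) (h : t * s₀ = 1)
    (ih : dwbc x y u (List.ofFn s) * (Matrix.vandermonde u).det * (Matrix.vandermonde s).det =
      (ikMatrix x y u s).det) :
    dwbc x y (Fin.cons t u : Fin (n + 1) → A) (s₀ :: List.ofFn s) *
        (Matrix.vandermonde (Fin.cons t u : Fin (n + 1) → A)).det *
        (Matrix.vandermonde (Fin.cons s₀ s : Fin (n + 1) → A)).det =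
      (ikMatrix x y (Fin.cons t u : Fin (n + 1) → A) (Fin.cons s₀ s : Fin (n + 1) → A)).det := by
  have hsub : (ikMatrix x y (Fin.cons t u : Fin (n + 1) → A)
      (Fin.cons s₀ s : Fin (n + 1) → A)).submatrix (Fin.succAbove 0) Fin.succ =
      .of fun i j => ((1 - u j * s₀) * weightB x y (u j) s₀) * ikMatrix x y u s i j := by
    ext i j
    simp [ikMatrix, prod_erase_succ]
  rw [Matrix.det_succ_column_zero (ikMatrix x y _ _), Fin.sum_univ_succ, sum_eq_zero, hsub,
    Matrix.det_mul_row, ← ih,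
    dwbc_cons_of_mul_eq_one x y u _ _ h, det_vandermonde_cons, det_vandermonde_cons]
  · have h1 : (∏ j, (1 - t * s j)) * ∏ j, (1 - u j * s₀) = (∏ j, (u j - t)) * ∏ j, (s j - s₀) := by
      rw [← prod_mul_distrib, ← prod_mul_distrib]
      refine prod_congr rfl fun j _ => ?_
      linear_combination (u j * s j - 1) * h
    have h2 : ikMatrix x y (Fin.cons t u : Fin (n + 1) → A) (Fin.cons s₀ s : Fin (n + 1) → A) 0 0 =
        (∏ j, (1 - t * s j)) * ((List.ofFn s).map fun s => weightB x y t s).prod := by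
      rw [List.map_ofFn, List.prod_ofFn, ← prod_mul_distrib]
      simp [ikMatrix, erase_zero_univ]
    rw [h2, prod_mul_distrib]
    simp only [Fin.val_zero, pow_zero, one_mul, add_zero]
    linear_combination (-(((List.ofFn s).map fun s => weightB x y t s).prod *
      (∏ j, weightB x y (u j) s₀) * dwbc x y u (List.ofFn s) *
      (Matrix.vandermonde u).det * (Matrix.vandermonde s).det)) * h1
  · intro i _
    have : ikMatrix x y (Fin.cons t u : Fin (n + 1) → A) (Fin.cons s₀ s : Fin (n + 1) → A)
        i.succ 0 = 0 := by
      simp [ikMatrix, prod_erase_succ, h]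
    rw [this]
    ring

end Ring

/-- Interpolation in the first column parameter: both sides have degree at most 2n in it and agree
at 2n + 1 points. These are the n + 1 inverses of the row parameters, where the recursion applies
after a permutation of rows, and the n other column parameters, where both sides vanish. The
hypotheses keep the points distinct and allow the permutation. -/
theorem dwbc_mul_eq_det {K : Type*} [Field K] (x y : K) {n : ℕ} (u s : Fin n → K)
    (hu : u.Injective) (hs : s.Injective) (hs0 : ∀ i, s i ≠ 0) (hus : ∀ i j, u j * s i ≠ 1)
    (hR : ∀ i j, i ≠ j → s i * s j + (y - x) * s i - s j + x ≠ 0) :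
    dwbc x y u (List.ofFn s) * (Matrix.vandermonde u).det * (Matrix.vandermonde s).det =
      (ikMatrix x y u s).det := by
  induction n with
  | zero => simp [dwbc, Matrix.one_apply, funext_iff]
  | succ n ih =>
    obtain ⟨u₀, u, rfl⟩ : ∃ u₀ u', u = (Fin.cons u₀ u' : Fin (n + 1) → K) :=
      ⟨u 0, Fin.tail u, (Fin.cons_self_tail u).symm⟩
    rw [Fin.cons_injective_iff] at hu
    rw [← sub_eq_zero]
    classical
    have hinv : Function.Injective fun i => (s i)⁻¹ := inv_injective.comp hs
    refine IsPolyFun.eq_zero (d := 2 * n) (f := fun t => dwbc x y (Fin.cons t u : Fin (n + 1) → K)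
      (List.ofFn s) * (Matrix.vandermonde (Fin.cons t u : Fin (n + 1) → K)).det *
        (Matrix.vandermonde s).det - (ikMatrix x y (Fin.cons t u : Fin (n + 1) → K) s).det) ?_
      (univ.image (fun i => (s i)⁻¹) ∪ univ.image u) ?_ ?_ u₀
    · refine IsPolyFun.sub ?_ ?_
      · refine ((((isPolyFun_dwbc x y u (List.ofFn s) n (by simp)).mul (e := n) ?_)).mul
          (IsPolyFun.const _)).mono (by omega)
        simp only [det_vandermonde_cons]
        refine ((IsPolyFun.prod 1 univ fun j => ?_).mul (IsPolyFun.const _)).mono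
          (d := 1 * #(univ : Finset (Fin n)) + 0) (by simp)
        simpa using IsPolyFun.linear (u j) 1
      · simp only [Matrix.det_succ_column_zero]
        refine IsPolyFun.sum _ fun i => ?_
        have hsub : ∀ t, (ikMatrix x y (Fin.cons t u : Fin (n + 1) → K) s).submatrix i.succAbove
            Fin.succ = (ikMatrix x y (Fin.cons 0 u : Fin (n + 1) → K) s).submatrix i.succAbove
              Fin.succ := by
          intro t
          ext k j
          simp [ikMatrix]
        simp only [hsub]
        refine (((IsPolyFun.const _).mul (e := 2 * n) ?_).mul (IsPolyFun.const _)).mono (by omega)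
        simp only [ikMatrix, Matrix.of_apply, Fin.cons_zero]
        refine (IsPolyFun.prod 2 (univ.erase i) fun k => ?_).mono (by simp)
        refine IsPolyFun.mul (d := 1) (e := 1) ?_ ?_
        · convert IsPolyFun.linear 1 (s k) using 2
          ring
        · convert IsPolyFun.linear (1 - s k) (x + (y - x) * s k) using 2
          unfold weightB
          ring
    · rw [card_union_of_disjoint, card_image_of_injective _ hinv, card_image_of_injective _ hu.2]
      · simp
        omega
      · rw [disjoint_left]
        simp only [mem_image, mem_univ, true_and]
        rintro _ ⟨i, rfl⟩ ⟨j, hj⟩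
        apply hus i j.succ
        simp [hj, hs0]
    · intro t ht
      rw [mem_union, mem_image, mem_image] at ht
      rcases ht with ⟨i, -, rfl⟩ | ⟨j, -, rfl⟩
      -- The permutation brings s i to the front. It leaves the partition function unchanged and
      -- multiplies the Vandermonde determinant of s and the determinant of `ikMatrix` by the same
      -- sign.
      · set σ : Equiv.Perm (Fin (n + 1)) := i.cycleRange.symm with hσ
        have hsσ : s ∘ σ = (Fin.cons (s i) (fun k => s (i.succAbove k)) : Fin (n + 1) → K) := by
          ext k
          cases k using Fin.cases <;> simp [hσ]
        have hperm : dwbc x y (Fin.cons (s i)⁻¹ u : Fin (n + 1) → K) (List.ofFn s) =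
            dwbc x y (Fin.cons (s i)⁻¹ u : Fin (n + 1) → K) (List.ofFn (s ∘ σ)) := by
          refine dwbc_perm x y _ (σ.ofFn_comp_perm s).symm ?_
          rw [List.pairwise_ofFn]
          exact fun a b hab => hR a b hab.ne
        have key := dwbc_mul_eq_det_of_mul_eq_one x y u (s i)⁻¹ (s₀ := s i)
          (fun k => s (i.succAbove k)) (inv_mul_cancel₀ (hs0 i))
          (ih u _ hu.2 (hs.comp Fin.succAbove_right_injective) (fun k => hs0 _)
            (fun k j => by simpa using hus (i.succAbove k) j.succ)
            (fun a b hab => hR _ _ (Fin.succAbove_right_injective.ne hab)))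
        have hV : Matrix.vandermonde (s ∘ σ) = (Matrix.vandermonde s).submatrix σ id := rfl
        have hl : s i :: List.ofFn (fun k => s (i.succAbove k)) = List.ofFn (s ∘ σ) := by
          rw [hsσ, List.ofFn_cons]
        rw [hl, ← hsσ, ikMatrix_comp_perm, hV, Matrix.det_permute, Matrix.det_permute,
          ← hperm] at key
        have hsq : ((Equiv.Perm.sign σ : ℤ) : K) * ((Equiv.Perm.sign σ : ℤ) : K) = 1 := by
          rw [← Int.cast_mul, ← Units.val_mul, Int.units_mul_self]
          simp
        linear_combination ((Equiv.Perm.sign σ : ℤ) : K) * key - (dwbc x y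
          (Fin.cons (s i)⁻¹ u : Fin (n + 1) → K) (List.ofFn s) *
          (Matrix.vandermonde (Fin.cons (s i)⁻¹ u : Fin (n + 1) → K)).det *
          (Matrix.vandermonde s).det - (ikMatrix x y (Fin.cons (s i)⁻¹ u : Fin (n + 1) → K) s).det)
          * hsq
      · rw [det_vandermonde_cons, prod_eq_zero (mem_univ j) (sub_self _),
          Matrix.det_zero_of_column_eq (M := ikMatrix x y _ s) (Fin.succ_ne_zero j).symm
            (fun k => by simp [ikMatrix])]
        ring

end IzerginKorepin

/-! ### Confluent form of the determinant -/

section Confluent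

open Polynomial

variable {A : Type*} [CommRing A] (x y : A) {n : ℕ}

/-- Coefficients of `∏_{k ≠ i} (a - b s_k)` as a form in `a` and `b`. -/
def prodCoeff (s : Fin n → A) : Matrix (Fin n) (Fin n) A :=
  .of fun i m => ∑ t ∈ (univ.erase i).powersetCard m, ∏ k ∈ t, -s k

theorem prod_erase_eq_sum (s : Fin n → A) (i : Fin n) (a b : A) :
    ∏ k ∈ univ.erase i, (a - b * s k) = ∑ m : Fin n, prodCoeff s i m * (b ^ m.1 * a ^ m.rev.1) := by
  have hn : n = n - 1 + 1 := by have := i.pos; omega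
  have h1 : ∀ k, a - b * s k = b * -s k + a := fun k => by ring
  simp only [h1]
  rw [prod_add, sum_powerset, card_erase_of_mem (mem_univ i), card_univ, Fintype.card_fin, ← hn,
    Finset.sum_range]
  refine sum_congr rfl fun m _ => ?_
  rw [prodCoeff, Matrix.of_apply, sum_mul]
  refine sum_congr rfl fun t ht => ?_
  rw [mem_powersetCard] at ht
  rw [prod_mul_distrib, prod_const, prod_const, card_sdiff_of_subset ht.1,
    card_erase_of_mem (mem_univ i), ht.2, card_univ, Fintype.card_fin, Fin.val_rev]
  have : n - 1 - m.1 = n - (m.1 + 1) := by omega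
  rw [this]
  ring

/-- Evaluating the forms at (a, b) = (s_l, 1) gives a diagonal matrix with entries ∏_{k ≠ i} (s_i -
s_k). Its determinant is a product of two Vandermonde-type products, one of which is the determinant
of the evaluation matrix. -/
theorem det_prodCoeff [IsDomain A] (s : Fin n → A) (hs : s.Injective) :
    (prodCoeff s).det = (Matrix.vandermonde s).det := by
  have h : prodCoeff s * (Matrix.projVandermonde (fun _ => 1) s).transpose =
      Matrix.diagonal fun i => ∏ k ∈ univ.erase i, (s i - s k) := by
    ext i l
    rw [Matrix.mul_apply]
    have := prod_erase_eq_sum s i (s l) 1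
    simp only [one_mul, one_pow] at this
    simp only [Matrix.transpose_apply, Matrix.projVandermonde_apply, one_pow, one_mul]
    rw [← this]
    by_cases hil : i = l
    · subst hil
      simp
    · rw [Matrix.diagonal_apply_ne _ hil]
      exact prod_eq_zero (mem_erase.2 ⟨Ne.symm hil, mem_univ l⟩) (sub_self _)
  have h2 := congrArg Matrix.det h
  rw [Matrix.det_mul, Matrix.det_transpose, Matrix.det_diagonal, Matrix.det_projVandermonde] at h2
  have h3 := prod_prod_Ioi_mul_eq_prod_prod_off_diag fun i j => s j - s i
  simp only [prod_mul_distrib, one_mul, compl_singleton] at h2 h3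
  rw [← h3] at h2
  rw [Matrix.det_vandermonde]
  have hne : ∏ i, ∏ j ∈ Ioi i, (s i - s j) ≠ 0 := by
    refine prod_ne_zero_iff.2 fun i _ => prod_ne_zero_iff.2 fun j hj => ?_
    exact sub_ne_zero.2 (hs.ne (mem_Ioi.1 hj).ne)
  refine mul_right_cancel₀ hne (h2.trans ?_)
  ring

/-- The polynomials whose values at the column parameters form the numerator of the
Izergin–Korepin formula, with the Vandermonde determinant of the row parameters removed. -/
noncomputable def numPoly (s : Fin n → A) (m : Fin n) : A[X] :=
  (∏ k, (1 - X * C (s k))) * ((1 + C (y - x) * X) ^ (m.1 + 1) * (1 - C x * X) ^ m.rev.1) -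
    (∏ k, (1 - C x * X - (1 + C (y - x) * X) * C (s k))) * X ^ (m.1 + 1)

/-- With a = 1 - us and b = `weightB`, one has a (1 + (y - x) u) - b u = 1 + (y - x - 1) u + x u².
Hence this factor over ab splits into partial fractions. Clearing denominators leaves products over
k ≠ i of forms linear in s_k, to which `prod_erase_eq_sum` applies. -/
theorem mul_ikMatrix_eq (u s : Fin n → A) (i j : Fin n) :
    (1 + (y - x - 1) * u j + x * u j ^ 2) * ikMatrix x y u s i j =
      ∑ m, prodCoeff s i m * (numPoly x y s m).eval (u j) := by
  have e1 := prod_erase_eq_sum s i 1 (u j)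
  have e2 := prod_erase_eq_sum s i (1 - x * u j) (1 + (y - x) * u j)
  have p1 := mul_prod_erase univ (fun k => 1 - u j * s k) (mem_univ i)
  have p2 := mul_prod_erase univ (fun k => 1 - x * u j - (1 + (y - x) * u j) * s k) (mem_univ i)
  have hL : ∑ m, prodCoeff s i m * (numPoly x y s m).eval (u j) =
      (∏ k, (1 - u j * s k)) * (1 + (y - x) * u j) *
        (∏ k ∈ univ.erase i, (1 - x * u j - (1 + (y - x) * u j) * s k)) -
      (∏ k, (1 - x * u j - (1 + (y - x) * u j) * s k)) * u j *
        (∏ k ∈ univ.erase i, (1 - u j * s k)) := by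
    rw [e1, e2, mul_sum, mul_sum, ← sum_sub_distrib]
    refine sum_congr rfl fun m _ => ?_
    simp only [numPoly, eval_sub, eval_mul, eval_prod, eval_one, eval_X, eval_C, eval_pow, eval_add,
      one_pow]
    ring
  rw [hL, ← p1, ← p2, ikMatrix, Matrix.of_apply, prod_mul_distrib]
  simp only [weightB]
  ring

/-- The remainders of `numPoly` modulo the polynomial with roots the column parameters. -/
noncomputable def remMatrix (u s : Fin n → A) : Matrix (Fin n) (Fin n) A :=
  .of fun m l => (numPoly x y s m %ₘ ∏ j, (X - C (u j))).coeff l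

theorem prod_mul_dwbc_of_field {K : Type*} [Field K] (x y : K) (u s : Fin n → K)
    (hu : u.Injective) (hs : s.Injective) (hs0 : ∀ i, s i ≠ 0) (hus : ∀ i j, u j * s i ≠ 1)
    (hR : ∀ i j, i ≠ j → s i * s j + (y - x) * s i - s j + x ≠ 0) :
    (∏ j, (1 + (y - x - 1) * u j + x * u j ^ 2)) * dwbc x y u (List.ofFn s) =
      (remMatrix x y u s).det := by
  have hmonic : (∏ j, (X - C (u j))).Monic := monic_prod_of_monic _ _ fun j _ => monic_X_sub_C _
  -- A polynomial and its remainder agree at the roots u j, and the remainder has fewer than n + 1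
  -- coefficients, so a Vandermonde factor comes out.
  have h1 : remMatrix x y u s * (Matrix.vandermonde u).transpose =
      .of fun m j => (numPoly x y s m).eval (u j) := by
    ext m j
    have hdeg : (numPoly x y s m %ₘ ∏ j, (X - C (u j))).natDegree < n := by
      have hn := m.pos
      refine (natDegree_modByMonic_lt _ hmonic fun h => ?_).trans_eq ?_
      · have := congrArg natDegree h
        rw [natDegree_finsetProd_X_sub_C_eq_card] at this
        simp at this
        omega
      · rw [natDegree_finsetProd_X_sub_C_eq_card]
        simp
    have hroot : eval (u j) (numPoly x y s m %ₘ ∏ j, (X - C (u j))) =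
        eval (u j) (numPoly x y s m) := by
      refine eval₂_modByMonic_eq_self_of_root ?_
      rw [← eval, eval_prod]
      exact prod_eq_zero (mem_univ j) (by simp)
    rw [Matrix.mul_apply, Matrix.of_apply, ← hroot, eval_eq_sum_range' hdeg, Finset.sum_range]
    simp [remMatrix]
  have h2 : (Matrix.of fun i j => (1 + (y - x - 1) * u j + x * u j ^ 2) * ikMatrix x y u s i j) =
      prodCoeff s * .of fun m j => (numPoly x y s m).eval (u j) := by
    ext i j
    rw [Matrix.mul_apply, Matrix.of_apply, mul_ikMatrix_eq]
    rfl
  have h3 := congrArg Matrix.det h2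
  rw [Matrix.det_mul_row, ← dwbc_mul_eq_det x y u s hu hs hs0 hus hR, Matrix.det_mul,
    det_prodCoeff s hs, ← h1, Matrix.det_mul, Matrix.det_transpose] at h3
  have hVu := Matrix.det_vandermonde_ne_zero_iff.2 hu
  have hVs := Matrix.det_vandermonde_ne_zero_iff.2 hs
  refine mul_right_cancel₀ (mul_ne_zero hVu hVs) ?_
  linear_combination h3

/-! ### Passage to arbitrary commutative rings -/

variable {B : Type*} [CommRing B] (f : A →+* B)

theorem map_vertexWeight (u s : A) (h v k w : Bool) :
    f (vertexWeight x y u s h v k w) = vertexWeight (f x) (f y) (f u) (f s) h v k w := by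
  cases h <;> cases v <;> cases k <;> cases w <;> simp [vertexWeight]

theorem map_rowTransfer (s : A) (u : Fin n → A) (h k : Bool) (v w : Fin n → Bool) :
    f (rowTransfer x y s u h k v w) = rowTransfer (f x) (f y) (f s) (f ∘ u) h k v w := by
  induction n generalizing h with
  | zero => cases h <;> cases k <;> simp [rowTransfer]
  | succ n ih =>
    simp only [rowTransfer, map_sum, map_mul, map_vertexWeight, ih]
    rfl

theorem map_dwbc (u : Fin n → A) (l : List A) :
    f (dwbc x y u l) = dwbc (f x) (f y) (f ∘ u) (l.map f) := by
  have : ∀ v w, f ((l.map fun s => rowOp x y s u).prod v w) =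
      ((l.map f).map fun s => rowOp (f x) (f y) s (f ∘ u)).prod v w := by
    induction l with
    | nil => intro v w; simp [Matrix.one_apply, apply_ite f]
    | cons s l ih =>
      intro v w
      simp only [List.map_cons, List.prod_cons, Matrix.mul_apply, map_sum, map_mul, ih]
      simp only [rowOp, map_rowTransfer]
  exact this _ _

theorem map_numPoly (s : Fin n → A) (m : Fin n) :
    (numPoly x y s m).map f = numPoly (f x) (f y) (f ∘ s) m := by
  simp [numPoly, Polynomial.map_prod]

theorem map_remMatrix (u s : Fin n → A) :
    f.mapMatrix (remMatrix x y u s) = remMatrix (f x) (f y) (f ∘ u) (f ∘ s) := by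
  ext m l
  have hmonic : (∏ j, (X - C (u j))).Monic := monic_prod_of_monic _ _ fun j _ => monic_X_sub_C _
  simp only [remMatrix, RingHom.mapMatrix_apply, Matrix.map_apply, Matrix.of_apply]
  rw [← coeff_map, map_modByMonic _ hmonic, map_numPoly]
  simp [Polynomial.map_prod]

/-- Without Vandermonde factors this is a polynomial identity, so independent variables over ℤ
suffice; there all genericity conditions hold, as evaluation at suitable integer points shows. -/
theorem prod_mul_dwbc (u s : Fin n → A) :
    (∏ j, (1 + (y - x - 1) * u j + x * u j ^ 2)) * dwbc x y u (List.ofFn s) =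
      (remMatrix x y u s).det := by
  let P := MvPolynomial (Bool ⊕ Fin n ⊕ Fin n) ℤ
  let K := FractionRing P
  let ι : P →+* K := algebraMap P K
  have hι : Function.Injective ι := IsFractionRing.injective P K
  let x' : P := .X (.inl true)
  let y' : P := .X (.inl false)
  let u' : Fin n → P := fun j => .X (.inr (.inl j))
  let s' : Fin n → P := fun j => .X (.inr (.inr j))
  have hne : ∀ (p q : P) (c : Bool ⊕ Fin n ⊕ Fin n → ℤ), MvPolynomial.eval c p ≠
      MvPolynomial.eval c q → ι p ≠ ι q := fun p q c h h' => h (congrArg _ (hι h'))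
  have h := prod_mul_dwbc_of_field (ι x') (ι y') (ι ∘ u') (ι ∘ s')
    (hι.comp fun i j h => by simpa using MvPolynomial.X_injective h)
    (hι.comp fun i j h => by simpa using MvPolynomial.X_injective h)
    (fun i => by
      rw [← map_zero ι]
      exact hne _ _ (fun _ => 1) (by simp [s']))
    (fun i j => by
      simp only [Function.comp, ← map_one ι, ← map_mul]
      exact hne _ _ (fun _ => 0) (by simp [s', u']))
    (fun i j _ => by
      simp only [Function.comp, ← map_zero ι, ← map_mul, ← map_add, ← map_sub]
      exact hne _ _ (fun k => if k = .inl true then 1 else 0) (by simp [s', x', y']))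
  have hP : (∏ j, (1 + (y' - x' - 1) * u' j + x' * u' j ^ 2)) * dwbc x' y' u' (List.ofFn s') =
      (remMatrix x' y' u' s').det := by
    apply hι
    rw [map_mul, map_dwbc, RingHom.map_det, map_remMatrix, List.map_ofFn, ← h]
    simp
  let g : P →+* A := MvPolynomial.eval₂Hom (Int.castRingHom A)
    (Sum.elim (fun b => bif b then x else y) (Sum.elim u s))
  have hx : g x' = x := MvPolynomial.eval₂Hom_X' _ _ _
  have hy : g y' = y := MvPolynomial.eval₂Hom_X' _ _ _
  have hu : g ∘ u' = u := funext fun _ => MvPolynomial.eval₂Hom_X' _ _ _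
  have hs : g ∘ s' = s := funext fun _ => MvPolynomial.eval₂Hom_X' _ _ _
  have h2 := congrArg g hP
  rw [map_mul, map_dwbc, RingHom.map_det, map_remMatrix, List.map_ofFn, hx, hy, hu, hs] at h2
  rw [← h2]
  simp [hx, hy, ← hu]

/-- With all column parameters equal to `0`. -/
theorem dwbc_zero_eq_det (s : Fin n → A) :
    dwbc x y (fun _ : Fin n => 0) (List.ofFn s) =
      (Matrix.of fun m l : Fin n => (numPoly x y s m).coeff l).det := by
  have h := prod_mul_dwbc x y (fun _ => 0) s
  simp only [mul_zero, add_zero, ne_eq, OfNat.ofNat_ne_zero, not_false_eq_true, zero_pow,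
    prod_const_one, one_mul] at h
  rw [h]
  congr 1
  ext m l
  simp only [remMatrix, Matrix.of_apply, C_0, sub_zero, prod_const, card_univ, Fintype.card_fin]
  -- For u = 0 the divisor is X^n, so the remainder is truncation and keeps the coefficients of
  -- index below n.
  have := congrArg (coeff · l.1) (modByMonic_add_div (numPoly x y s m) (X ^ n : A[X]))
  simp only [coeff_add, coeff_X_pow_mul'] at this
  rw [← this, if_neg (by have := l.2; omega), add_zero]

end Confluent

/-! ### Specialization to power series -/

section PathSeries

open PowerSeries

variable {K : Type*} [Field K] (x y z : K)

/-- The denominator `1 - x X` of the Möbius transformation. -/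
noncomputable def moebiusDen : K⟦X⟧ := 1 - C x * X

/-- The numerator `1 + (y - x) X` of the Möbius transformation. -/
noncomputable def moebiusNum : K⟦X⟧ := 1 + C (y - x) * X

/-- The generating function of the lattice paths which start at position `m` and height `h`, by the
position of their end. Steps at height `n` carry an additional factor `z`. -/
noncomputable def pathSeries (n m h : ℕ) : K⟦X⟧ :=
  -- Each height up to m contributes 1 / (1 - x X), and each height above m the Möbius factor. At
  -- height n, a part also carries z, so this last factor becomes `moebiusNum` / (`moebiusNum` - yz
  -- X).
  if h = n then
    (moebiusNum x y * (moebiusDen x)⁻¹) ^ (n - m) * ((moebiusDen x)⁻¹) ^ m * moebiusDen x *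
      (moebiusNum x y - C (y * z) * X)⁻¹
  else (moebiusNum x y * (moebiusDen x)⁻¹) ^ (h - m) * ((moebiusDen x)⁻¹) ^ (min h m)

theorem moebiusDen_mul_inv : moebiusDen x * (moebiusDen x)⁻¹ = 1 :=
  PowerSeries.mul_inv_cancel _ (by simp [moebiusDen])

theorem num_sub_mul_inv :
    (moebiusNum x y - C (y * z) * X) * (moebiusNum x y - C (y * z) * X)⁻¹ = 1 :=
  PowerSeries.mul_inv_cancel _ (by simp [moebiusNum])

/-- On truncated series, multiplication by h is a triangular Toeplitz matrix with diagonal entries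
h(0). -/
theorem det_coeff_mul (n : ℕ) (h : K⟦X⟧) (g : Fin n → K⟦X⟧) :
    (Matrix.of fun m l : Fin n => coeff l (h * g m)).det =
      constantCoeff h ^ n * (Matrix.of fun m l : Fin n => coeff l (g m)).det := by
  let T : Matrix (Fin n) (Fin n) K := .of fun k l => if k ≤ l then coeff (l.1 - k.1) h else 0
  have hT : T.det = constantCoeff h ^ n := by
    rw [Matrix.det_of_isUpperTriangular]
    · simp [T]
    · intro i j hij
      exact if_neg (not_le.2 hij)
  rw [← hT, mul_comm, ← Matrix.det_mul]
  congr 1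
  ext m l
  rw [Matrix.mul_apply, Matrix.of_apply, mul_comm h, coeff_mul, Nat.sum_antidiagonal_eq_sum_range_succ
    (fun a b => coeff a (g m) * coeff b h)]
  have : ∀ k : Fin n, coeff k.1 (g m) * T k l =
      (fun k : ℕ => if k ≤ l.1 then coeff k (g m) * coeff (l.1 - k) h else 0) k := by
    intro k
    simp only [T, Matrix.of_apply, Fin.le_def, mul_ite, mul_zero]
  simp only [Matrix.of_apply]
  rw [sum_congr rfl fun k _ => this k, ← Finset.sum_range
    (fun k : ℕ => if k ≤ l.1 then coeff k (g m) * coeff (l.1 - k) h else 0), ← sum_filter]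
  refine sum_congr ?_ fun _ _ => rfl
  ext k
  simp only [mem_range, mem_filter]
  omega

/-- Subtracting σ times the next row makes (1 - σX)(D - σM) D^N a common factor of all rows but the
last, with (M/D)^(m+1) - X^(m+1) left over. The last row fits the same pattern modulo X^(N+1), with
the modified series at height N + 1 and an extra factor z. -/
theorem det_numPoly_eq {σ : K} (hz : z * (1 - σ) = 1) (N : ℕ) :
    (Matrix.of fun m l : Fin (N + 1) =>
      (numPoly x y (Fin.cons σ fun _ => 0 : Fin (N + 1) → K) m).coeff l).det =
    (1 - σ) ^ N * (Matrix.of fun m l : Fin (N + 1) =>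
      coeff l (pathSeries x y z (N + 1) 0 (m.1 + 1)) - if l.1 = m.1 + 1 then 1 else 0).det := by
  set D := moebiusDen x with hD
  set M := moebiusNum x y with hM
  have hDinv := moebiusDen_mul_inv x
  have hRinv := num_sub_mul_inv x y z
  rw [← hD] at hDinv
  rw [← hM] at hRinv
  have hDs : D - C σ * M = C (1 - σ) * (M - C (y * z) * X) := by
    have h1 : C z * (1 - C σ) = (1 : K⟦X⟧) := by rw [← map_one C, ← map_sub, ← map_mul, hz]
    simp only [hD, hM, moebiusDen, moebiusNum, map_sub, map_mul, map_one]
    linear_combination C y * X * h1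
  let f : Fin (N + 1) → K⟦X⟧ := fun m =>
    (1 - C σ * X) * (M ^ (m.1 + 1) * D ^ m.rev.1) - (D - C σ * M) * D ^ N * X ^ (m.1 + 1)
  have hf : ∀ m l, (numPoly x y (Fin.cons σ fun _ => 0 : Fin (N + 1) → K) m).coeff l =
      coeff l (f m) := by
    intro m l
    rw [← Polynomial.coeff_coe]
    congr 1
    simp only [numPoly, f, hD, hM, moebiusDen, moebiusNum, Fin.prod_univ_succ, Fin.cons_zero,
      Fin.cons_succ, Polynomial.C_0, mul_zero, sub_zero, prod_const_one, mul_one, prod_const,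
      card_univ, Fintype.card_fin, Polynomial.coe_sub, Polynomial.coe_mul, Polynomial.coe_add,
      Polynomial.coe_pow, Polynomial.coe_C, Polynomial.coe_X, Polynomial.coe_one]
    ring
  let U : Matrix (Fin (N + 1)) (Fin (N + 1)) K :=
    .of fun m k => if k = m then 1 else if k.1 = m.1 + 1 then -σ else 0
  have hU : U.det = 1 := by
    rw [Matrix.det_of_isUpperTriangular]
    · simp [U]
    · intro i j hij
      have : j < i := hij
      simp only [U, Matrix.of_apply]
      rw [if_neg (by omega), if_neg (by omega)]
  -- The factor z of the last row cancels one of the N + 1 factors 1 - σ coming from the constant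
  -- coefficient of h.
  let c : Fin (N + 1) → K := fun m => if m = Fin.last N then z else 1
  have hc : ∏ m, c m = z := by simp [c]
  let h : K⟦X⟧ := (1 - C σ * X) * ((D - C σ * M) * D ^ N)
  have hh : constantCoeff h = 1 - σ := by simp [h, hD, hM, moebiusDen, moebiusNum]
  have hrow : ∀ m l : Fin (N + 1), ∑ k, U m k * coeff l (f k) =
      coeff l (h * (C (c m) * (pathSeries x y z (N + 1) 0 (m.1 + 1) - X ^ (m.1 + 1)))) := by
    intro m l
    rcases Fin.eq_castSucc_or_eq_last m with ⟨m, rfl⟩ | rfl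
    · have h1 : ∑ k, U m.castSucc k * coeff l.1 (f k) =
          coeff l.1 (f m.castSucc - C σ * f m.succ) := by
        rw [map_sub, coeff_C_mul, sub_eq_add_neg, ← neg_mul]
        rw [sum_eq_add_of_mem m.castSucc m.succ (mem_univ _) (mem_univ _)
          (Fin.castSucc_lt_succ).ne]
        · simp [U, (Fin.castSucc_lt_succ).ne']
        · rintro k - ⟨hk1, hk2⟩
          simp only [U, Matrix.of_apply, if_neg hk1]
          rw [if_neg, zero_mul]
          intro hk
          exact hk2 (Fin.ext hk)
      rw [h1]
      congr 1
      have hm := m.2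
      have hr1 : m.castSucc.rev.1 = N - m.1 := by simp [Fin.val_rev]
      have hr2 : m.succ.rev.1 = N - m.1 - 1 := by simp [Fin.val_rev]; omega
      have hcm : c m.castSucc = 1 := if_neg (Fin.castSucc_lt_last m).ne
      simp only [f, h, hcm, map_one, one_mul, pathSeries, Fin.val_castSucc, Fin.val_succ, hr1, hr2]
      rw [if_neg (by omega)]
      obtain ⟨r, hr⟩ : ∃ r, N = m.1 + 1 + r := ⟨N - m.1 - 1, by omega⟩
      have e1 : N - m.1 = r + 1 := by omega
      have e2 : r + 1 - 1 = r := by omega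
      rw [e1, e2, Nat.sub_zero, min_eq_right (Nat.zero_le _), pow_zero, mul_one, mul_pow, ← hD, ← hM]
      have e3 : D ^ N * D⁻¹ ^ (m.1 + 1) = D ^ r := by
        have : D ^ N = D ^ (m.1 + 1) * D ^ r := by rw [← pow_add, ← hr]
        rw [this, mul_right_comm, ← mul_pow, hDinv, one_pow, one_mul]
      linear_combination (-(1 - C σ * X) * (D - C σ * M) * M ^ (m.1 + 1)) * e3
    · have h1 : ∑ k, U (Fin.last N) k * coeff l.1 (f k) = coeff l.1 (f (Fin.last N)) := by
        rw [sum_eq_single (Fin.last N)]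
        · simp [U]
        · intro k _ hk
          simp only [U, Matrix.of_apply, if_neg hk]
          rw [if_neg, zero_mul]
          have := k.2
          simp only [Fin.val_last]
          omega
        · simp
      rw [h1]
      have hX : ∀ p : K⟦X⟧, coeff l.1 (p * X ^ (N + 1)) = 0 := by
        intro p
        rw [coeff_mul_X_pow', if_neg (by have := l.2; omega)]
      have hcm : c (Fin.last N) = z := if_pos rfl
      have e4 : h * (C z * pathSeries x y z (N + 1) 0 (N + 1)) = (1 - C σ * X) * M ^ (N + 1) := by
        simp only [pathSeries, if_pos, Nat.sub_zero, pow_zero, mul_one, ← hD, ← hM, h, mul_pow, hDs]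
        have e3 : D ^ N * D⁻¹ ^ (N + 1) * D = 1 := by
          rw [mul_right_comm, ← pow_succ, ← mul_pow, hDinv, one_pow]
        have e5 : C z * C (1 - σ) = (1 : K⟦X⟧) := by rw [← map_mul, hz, map_one]
        calc _ = (1 - C σ * X) * M ^ (N + 1) * (C z * C (1 - σ)) *
              ((M - C (y * z) * X) * (M - C (y * z) * X)⁻¹) * (D ^ N * D⁻¹ ^ (N + 1) * D) := by ring
          _ = _ := by rw [e3, e5, hRinv]; ring
      rw [hcm, Fin.val_last, mul_sub, mul_sub, e4, ← mul_assoc]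
      simp only [f, Fin.val_last, map_sub, hX, Fin.rev_last, Fin.val_zero, pow_zero, mul_one]
  have hmat : U * (Matrix.of fun m l : Fin (N + 1) =>
      (numPoly x y (Fin.cons σ fun _ => 0 : Fin (N + 1) → K) m).coeff l) =
      .of fun m l : Fin (N + 1) =>
        coeff l (h * (C (c m) * (pathSeries x y z (N + 1) 0 (m.1 + 1) - X ^ (m.1 + 1)))) := by
    ext m l
    rw [Matrix.mul_apply, Matrix.of_apply, ← hrow]
    simp [hf]
  have hdet := congrArg Matrix.det hmat
  rw [Matrix.det_mul, hU, one_mul, det_coeff_mul, hh] at hdet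
  simp only [coeff_C_mul] at hdet
  have hcol := Matrix.det_mul_column c (Matrix.of fun m l : Fin (N + 1) =>
    coeff l.1 (pathSeries x y z (N + 1) 0 (m.1 + 1) - X ^ (m.1 + 1)))
  simp only [Matrix.of_apply] at hcol
  rw [hcol, hc, pow_succ] at hdet
  simp only [map_sub, coeff_X_pow] at hdet
  rw [hdet]
  linear_combination ((1 - σ) ^ N * (Matrix.of fun m l : Fin (N + 1) =>
      coeff l (pathSeries x y z (N + 1) 0 (m.1 + 1)) - if l.1 = m.1 + 1 then 1 else 0).det) * hz

end PathSeries

/-! ### Alternating sign matrices as six-vertex configurations -/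

section StateSum

theorem prod_ofFn_apply {ι A : Type*} [Fintype ι] [DecidableEq ι] [CommRing A] {n : ℕ}
    (M : Fin n → Matrix ι ι A) (v w : ι) :
    (List.ofFn M).prod v w = ∑ V : Fin (n + 1) → ι,
      if V 0 = v ∧ V (Fin.last n) = w then ∏ i, M i (V i.castSucc) (V i.succ) else 0 := by
  induction n generalizing v with
  | zero =>
    rw [sum_fin_succ_fun]
    simp only [univ_unique, sum_singleton]
    rw [sum_eq_single v]
    · simp [Matrix.one_apply, Fin.last]
    · intro b _ hb
      rw [if_neg]
      simp [hb]
    · simp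
  | succ n ih =>
    rw [List.ofFn_succ, List.prod_cons, Matrix.mul_apply, sum_fin_succ_fun]
    symm
    rw [sum_eq_single v]
    · symm
      simp only [ih, mul_sum]
      rw [sum_comm]
      refine sum_congr rfl fun V _ => ?_
      rw [sum_eq_single (V 0)]
      · simp only [true_and, Fin.cons_zero, ← Fin.succ_last, Fin.cons_succ, Fin.prod_univ_succ,
          Fin.castSucc_zero, ← Fin.succ_castSucc, mul_ite, mul_zero]
      · intro b _ hb
        rw [if_neg (fun h => hb h.1.symm), mul_zero]
      · simp
    · intro b _ hb
      refine sum_eq_zero fun V _ => if_neg ?_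
      simp [hb]
    · simp

variable {A : Type*} [CommRing A] (x y : A) {n : ℕ}

theorem rowTransfer_eq_prod (s : A) (u : Fin n → A) (h k : Bool) (v w : Fin n → Bool) :
    rowTransfer x y s u h k v w = (List.ofFn fun j => (Matrix.of fun h g =>
      vertexWeight x y (u j) s h (v j) g (w j) : Matrix Bool Bool A)).prod h k := by
  induction n generalizing h with
  | zero => simp [rowTransfer, Matrix.one_apply]
  | succ n ih =>
    rw [List.ofFn_succ, List.prod_cons, Matrix.mul_apply]
    simp only [rowTransfer, ih]
    rfl

/-- The boundary conditions for vertical edge states `V` and horizontal edge states `G`. -/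
def IsDomainWall (p : (Fin (n + 1) → Fin n → Bool) × (Fin n → Fin (n + 1) → Bool)) : Prop :=
  (p.1 0 = (fun _ => false) ∧ p.1 (Fin.last n) = fun _ => true) ∧
    ∀ i, p.2 i 0 = false ∧ p.2 i (Fin.last n) = true

instance : DecidablePred (IsDomainWall (n := n)) :=
  fun _ => inferInstanceAs (Decidable (_ ∧ _))

theorem dwbc_eq_sum (u s : Fin n → A) :
    dwbc x y u (List.ofFn s) =
      ∑ p : (Fin (n + 1) → Fin n → Bool) × (Fin n → Fin (n + 1) → Bool),
      if IsDomainWall p then ∏ i, ∏ j, vertexWeight x y (u j) (s i) (p.2 i j.castSucc)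
        (p.1 i.castSucc j) (p.2 i j.succ) (p.1 i.succ j) else 0 := by
  rw [dwbc, List.map_ofFn, prod_ofFn_apply, Fintype.sum_prod_type]
  refine sum_congr rfl fun V _ => ?_
  simp only [Function.comp, rowOp, rowTransfer_eq_prod, prod_ofFn_apply, prod_univ_sum,
    Fintype.piFinset_univ, prod_ite_zero, mem_univ, true_imp_iff, Matrix.of_apply, IsDomainWall]
  split_ifs with h
  · simp [h]
  · simp [h]

end StateSum

/-! ### Partial sums and edge states -/

section PartialSums

variable {n : ℕ}

/-- The sum of the first `i` entries. -/
def psum (f : Fin n → ℤ) (i : Fin (n + 1)) : ℤ := ∑ k with k.castSucc < i, f k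

theorem psum_zero (f : Fin n → ℤ) : psum f 0 = 0 := by simp [psum]

theorem psum_castSucc (f : Fin n → ℤ) (i : Fin n) : psum f i.castSucc = ∑ k ∈ Iio i, f k := by
  rw [psum]
  congr 1
  ext k
  simp

theorem psum_succ (f : Fin n → ℤ) (i : Fin n) : psum f i.succ = ∑ k ∈ Iic i, f k := by
  rw [psum]
  congr 1
  ext k
  simp only [mem_filter, mem_univ, true_and, mem_Iic, Fin.lt_def, Fin.le_def, Fin.val_castSucc,
    Fin.val_succ]
  omega

theorem psum_succ_eq_add (f : Fin n → ℤ) (i : Fin n) : psum f i.succ = psum f i.castSucc + f i := by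
  rw [psum_succ, psum_castSucc, sum_Iic_eq]

theorem psum_last (f : Fin n → ℤ) : psum f (Fin.last n) = ∑ k, f k := by
  simp [psum, Fin.castSucc_lt_last]

theorem psum_sub (F : Fin (n + 1) → ℤ) (i : Fin (n + 1)) :
    psum (fun k => F k.succ - F k.castSucc) i = F i - F 0 := by
  induction i using Fin.induction with
  | zero => simp [psum_zero]
  | succ i ih =>
    rw [psum_succ_eq_add, ih]
    ring

/-- The integer value of an edge state. -/
def bit (b : Bool) : ℤ := if b then 1 else 0

theorem bit_mem (b : Bool) : 0 ≤ bit b ∧ bit b ≤ 1 := by cases b <;> simp [bit]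

theorem bit_decide {a : ℤ} (h : 0 ≤ a ∧ a ≤ 1) : bit (decide (a = 1)) = a := by
  by_cases h1 : a = 1
  · simp [bit, h1]
  · simp only [bit, h1, decide_false, Bool.false_eq_true, if_false]
    omega

theorem psum_mem {f : Fin n → ℤ} (h : ∀ k, 0 ≤ ∑ i ∈ Iic k, f i ∧ ∑ i ∈ Iic k, f i ≤ 1)
    (i : Fin (n + 1)) : 0 ≤ psum f i ∧ psum f i ≤ 1 := by
  cases i using Fin.cases with
  | zero => simp [psum_zero]
  | succ i => rw [psum_succ]; exact h i

end PartialSums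

/-! ### Alternating sign matrices and ice configurations -/

section Bijection

variable {n : ℕ}

/-- The edge states of the six-vertex configuration of an alternating sign matrix. -/
def edgeStates (B : Matrix (Fin n) (Fin n) ℤ) :
    (Fin (n + 1) → Fin n → Bool) × (Fin n → Fin (n + 1) → Bool) :=
  (fun i j => decide (psum (fun k => B k j) i = 1), fun i j => decide (psum (B i) j = 1))

variable {B : Matrix (Fin n) (Fin n) ℤ}

theorem bit_edgeStates_fst (hB : IsASM B) (i : Fin (n + 1)) (j : Fin n) :
    bit ((edgeStates B).1 i j) = psum (fun k => B k j) i :=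
  bit_decide (psum_mem (fun k => hB.col_partial k j) i)

theorem bit_edgeStates_snd (hB : IsASM B) (i : Fin n) (j : Fin (n + 1)) :
    bit ((edgeStates B).2 i j) = psum (B i) j :=
  bit_decide (psum_mem (fun k => hB.row_partial i k) j)

theorem isDomainWall_edgeStates (hB : IsASM B) : IsDomainWall (edgeStates B) := by
  refine ⟨⟨?_, ?_⟩, fun i => ⟨?_, ?_⟩⟩
  · ext j; simp [edgeStates, psum_zero]
  · ext j; simp [edgeStates, psum_last, hB.col_sum]
  · simp [edgeStates, psum_zero]
  · simp [edgeStates, psum_last, hB.row_sum]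

theorem edgeStates_injOn : Set.InjOn edgeStates {B : Matrix (Fin n) (Fin n) ℤ | IsASM B} := by
  intro B hB B' hB' h
  have key : ∀ i j, psum (B i) j = psum (B' i) j := fun i j => by
    rw [← bit_edgeStates_snd hB, ← bit_edgeStates_snd hB', h]
  ext i j
  have h1 := psum_succ_eq_add (B i) j
  have h2 := psum_succ_eq_add (B' i) j
  rw [key, key] at h1
  omega

/-- By the ice rule the differences of vertical states are also those of horizontal states, so one
matrix has both families of edge states as its partial sums. -/
theorem exists_asm_of_ice {p : (Fin (n + 1) → Fin n → Bool) × (Fin n → Fin (n + 1) → Bool)}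
    (hp : IsDomainWall p) (hice : ∀ i j, bit (p.1 i.succ j) - bit (p.1 i.castSucc j) =
      bit (p.2 i j.succ) - bit (p.2 i j.castSucc)) :
    ∃ B : Matrix (Fin n) (Fin n) ℤ, IsASM B ∧ edgeStates B = p := by
  let B : Matrix (Fin n) (Fin n) ℤ := .of fun i j => bit (p.1 i.succ j) - bit (p.1 i.castSucc j)
  have hcol : ∀ i j, psum (fun k => B k j) i = bit (p.1 i j) := by
    intro i j
    have := psum_sub (fun k => bit (p.1 k j)) i
    simp only [hp.1.1] at this
    simpa [B, bit] using this
  have hrow : ∀ i j, psum (B i) j = bit (p.2 i j) := by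
    intro i j
    have := psum_sub (fun k => bit (p.2 i k)) j
    simp only [(hp.2 i).1] at this
    have hB : B i = fun j => bit (p.2 i j.succ) - bit (p.2 i j.castSucc) := by
      ext j
      exact hice i j
    rw [hB, this]
    simp [bit]
  refine ⟨B, ⟨?_, ?_, ?_, ?_, ?_⟩, ?_⟩
  · intro i j
    have h1 := bit_mem (p.1 i.succ j)
    have h2 := bit_mem (p.1 i.castSucc j)
    have h3 : B i j = bit (p.1 i.succ j) - bit (p.1 i.castSucc j) := rfl
    omega
  · intro k j
    rw [← psum_succ (fun i => B i j), hcol]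
    exact bit_mem _
  · intro i k
    rw [← psum_succ (fun j => B i j), hrow]
    exact bit_mem _
  · intro j
    rw [← psum_last fun i => B i j, hcol, hp.1.2]
    rfl
  · intro i
    rw [← psum_last fun j => B i j, hrow, (hp.2 i).2]
    rfl
  · ext i j
    · simp only [edgeStates, hcol]
      cases p.1 i j <;> simp [bit]
    · simp only [edgeStates, hrow]
      cases p.2 i j <;> simp [bit]

theorem ice_of_vertexWeight_ne_zero {A : Type*} [CommRing A] {x y u s : A} {h v k w : Bool}
    (hne : vertexWeight x y u s h v k w ≠ 0) : bit w - bit v = bit k - bit h := by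
  revert hne
  cases h <;> cases v <;> cases k <;> cases w <;> simp [vertexWeight, bit]

theorem dwbc_eq_sum_asm {A : Type*} [CommRing A] (x y : A) (u s : Fin n → A) :
    dwbc x y u (List.ofFn s) = ∑ B ∈ (finite_asm n).toFinset, ∏ i, ∏ j,
      vertexWeight x y (u j) (s i) ((edgeStates B).2 i j.castSucc) ((edgeStates B).1 i.castSucc j)
        ((edgeStates B).2 i j.succ) ((edgeStates B).1 i.succ j) := by
  rw [dwbc_eq_sum]
  symm
  refine sum_of_injOn edgeStates ?_ ?_ ?_ ?_
  · simpa using edgeStates_injOn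
  · simp [Set.MapsTo]
  · intro p _ hp
    split_ifs with hdw
    · by_contra hne
      refine hp ?_
      obtain ⟨B, hB, rfl⟩ := exists_asm_of_ice hdw fun i j => ice_of_vertexWeight_ne_zero
        fun h0 => hne (prod_eq_zero (mem_univ i) (prod_eq_zero (mem_univ j) h0))
      exact ⟨B, by simpa using hB, rfl⟩
    · rfl
  · intro B hB
    rw [if_pos (isDomainWall_edgeStates (by simpa using hB))]

end Bijection

/-! ### The determinant of alternating sign matrices -/

section ASMWeight

variable {N : ℕ} {B : Matrix (Fin (N + 1)) (Fin (N + 1)) ℤ}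

theorem exists_top_one (hB : IsASM B) : ∃ p, B 0 p = 1 ∧ ∀ j, j ≠ p → B 0 j = 0 := by
  have hnn : ∀ j, 0 ≤ B 0 j := by
    intro j
    have := (hB.col_partial 0 j).1
    have h0 : Iic (0 : Fin (N + 1)) = {0} := by ext; simp
    rwa [h0, sum_singleton] at this
  have h01 : ∀ j, B 0 j = 0 ∨ B 0 j = 1 := by
    intro j
    have := hnn j
    rcases hB.entry 0 j with h | h | h <;> omega
  have hex : ∃ p, B 0 p ≠ 0 := by
    by_contra! h
    have := hB.row_sum 0
    simp [h] at this
  obtain ⟨p, hp⟩ := hex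
  have hp1 : B 0 p = 1 := (h01 p).resolve_left hp
  refine ⟨p, hp1, fun j hj => ?_⟩
  have h := hB.row_sum 0
  rw [← add_sum_erase _ _ (mem_univ p), hp1] at h
  have hs : ∑ k ∈ univ.erase p, B 0 k = 0 := by omega
  exact (sum_eq_zero_iff_of_nonneg fun k _ => hnn k).1 hs j (by simp [hj])

/-- In the top row the left edge of a column is 1 exactly to the right of the unique entry 1. -/
theorem topZeros_add_card (hB : IsASM B) :
    topZeros B + #{j : Fin (N + 1) | (edgeStates B).2 0 j.castSucc = true} = N := by
  obtain ⟨p, hp, h0⟩ := exists_top_one hB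
  have h1 : topZeros B = p := by
    rw [topZeros, ← Fin.card_Iio p]
    congr 1
    ext j
    simp only [mem_filter, mem_univ, true_and, mem_Iio]
    change B 0 j = 0 ∧ (∃ l, j < l ∧ B 0 l = 1) ↔ j < p
    constructor
    · rintro ⟨-, l, hl, hl1⟩
      by_cases hlp : l = p
      · exact hlp ▸ hl
      · rw [h0 l hlp] at hl1
        omega
    · exact fun h => ⟨h0 j h.ne, p, h, hp⟩
  have h2 : (univ.filter fun j : Fin (N + 1) => (edgeStates B).2 0 j.castSucc = true) = Ioi p := by
    ext j
    simp only [edgeStates, mem_filter, mem_univ, true_and, decide_eq_true_eq, mem_Ioi, psum_castSucc]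
    have : ∑ k ∈ Iio j, B 0 k = if p < j then 1 else 0 := by
      split_ifs with h
      · rw [sum_eq_single_of_mem p (mem_Iio.2 h) fun k _ hk => h0 k hk, hp]
      · refine sum_eq_zero fun k hk => h0 k ?_
        rintro rfl
        exact h (mem_Iio.1 hk)
    rw [this]
    split_ifs <;> simp_all
  rw [h1, h2, Fin.card_Ioi]
  omega

theorem entry_eq_neg_one_iff (hB : IsASM B) (i j : Fin (N + 1)) : B i j = -1 ↔
    (edgeStates B).2 i j.castSucc = true ∧ (edgeStates B).1 i.castSucc j = true ∧
    (edgeStates B).2 i j.succ = false ∧ (edgeStates B).1 i.succ j = false := by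
  have h1 := psum_succ_eq_add (B i) j
  have h2 := psum_succ_eq_add (fun k => B k j) i
  rw [← bit_edgeStates_snd hB, ← bit_edgeStates_snd hB] at h1
  rw [← bit_edgeStates_fst hB, ← bit_edgeStates_fst hB] at h2
  revert h1 h2
  cases (edgeStates B).2 i j.castSucc <;> cases (edgeStates B).1 i.castSucc j <;>
    cases (edgeStates B).2 i j.succ <;> cases (edgeStates B).1 i.succ j <;>
    simp [bit] <;> omega

theorem inv_eq_card (hB : IsASM B) :
    inv B = #{p : Fin (N + 1) × Fin (N + 1) | (edgeStates B).2 p.1 p.2.castSucc = true ∧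
      (edgeStates B).1 p.1.castSucc p.2 = true} := by
  rw [inv_eq, card_filter, Nat.cast_sum]
  refine sum_congr rfl fun p _ => ?_
  rw [← psum_castSucc (fun i => B i p.2), ← psum_castSucc, ← bit_edgeStates_snd hB,
    ← bit_edgeStates_fst hB]
  cases (edgeStates B).2 p.1 p.2.castSucc <;> cases (edgeStates B).1 p.1.castSucc p.2 <;>
    simp [bit]

/-- Inv(B) counts the vertices with left and top state 1 (`inv_eq_card`). Those with entry -1
account for N(B); the others are the vertices of weight y. -/
theorem inv_sub_numNeg (hB : IsASM B) :
    (inv B - numNeg B).toNat = #{p : Fin (N + 1) × Fin (N + 1) |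
      ((edgeStates B).2 p.1 p.2.castSucc = true ∧ (edgeStates B).1 p.1.castSucc p.2 = true) ∧
      B p.1 p.2 ≠ -1} := by
  have h := card_filter_add_card_filter_not (s := univ.filter fun p : Fin (N + 1) × Fin (N + 1) =>
    (edgeStates B).2 p.1 p.2.castSucc = true ∧ (edgeStates B).1 p.1.castSucc p.2 = true)
    (fun p => B p.1 p.2 = -1)
  rw [filter_filter, filter_filter] at h
  have h2 : (univ.filter fun p : Fin (N + 1) × Fin (N + 1) =>
      ((edgeStates B).2 p.1 p.2.castSucc = true ∧ (edgeStates B).1 p.1.castSucc p.2 = true) ∧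
      B p.1 p.2 = -1) = univ.filter fun p : Fin (N + 1) × Fin (N + 1) => B p.1 p.2 = -1 := by
    refine filter_congr fun p _ => ?_
    rw [entry_eq_neg_one_iff hB]
    tauto
  rw [inv_eq_card hB, numNeg, ← h, h2]
  simp

theorem edgeStates_fst_zero (j : Fin (N + 1)) : (edgeStates B).1 0 j = false := by
  simp [edgeStates, psum_zero]

/-- At u = s = 0 the weights are 1, except y at all states 1 and x at an entry -1. In the top row
all top states are 0, so σ enters only through the straight crossing of weight 1 - σ. -/
theorem vertexWeight_edgeStates {A : Type*} [CommRing A] (x y σ : A) (hB : IsASM B)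
    (i j : Fin (N + 1)) :
    vertexWeight x y 0 ((Fin.cons σ fun _ => 0 : Fin (N + 1) → A) i)
      ((edgeStates B).2 i j.castSucc) ((edgeStates B).1 i.castSucc j)
      ((edgeStates B).2 i j.succ) ((edgeStates B).1 i.succ j) =
    (if B i j = -1 then x else 1) *
      (if ((edgeStates B).2 i j.castSucc = true ∧ (edgeStates B).1 i.castSucc j = true) ∧
        B i j ≠ -1 then y else 1) *
      (if i = 0 then if (edgeStates B).2 i j.castSucc = true then 1 - σ else 1 else 1) := by
  have h1 := psum_succ_eq_add (B i) j
  have h2 := psum_succ_eq_add (fun k => B k j) i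
  rw [← bit_edgeStates_snd hB, ← bit_edgeStates_snd hB] at h1
  rw [← bit_edgeStates_fst hB, ← bit_edgeStates_fst hB] at h2
  simp only [ne_eq, entry_eq_neg_one_iff hB]
  have h12 : bit ((edgeStates B).1 i.succ j) - bit ((edgeStates B).1 i.castSucc j) =
      bit ((edgeStates B).2 i j.succ) - bit ((edgeStates B).2 i j.castSucc) := by linarith
  clear h1 h2
  cases i using Fin.cases with
  | zero =>
    rw [Fin.castSucc_zero, edgeStates_fst_zero] at h12 ⊢
    revert h12
    cases (edgeStates B).2 0 j.castSucc <;> cases (edgeStates B).2 0 j.succ <;>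
      cases (edgeStates B).1 (Fin.succ 0) j <;> simp [bit, vertexWeight]
  | succ i =>
    revert h12
    cases (edgeStates B).2 i.succ j.castSucc <;> cases (edgeStates B).1 i.succ.castSucc j <;>
      cases (edgeStates B).2 i.succ j.succ <;> cases (edgeStates B).1 i.succ.succ j <;>
      simp [bit, vertexWeight]

theorem prod_vertexWeight_eq {A : Type*} [CommRing A] (x y z σ : A) (hz : z * (1 - σ) = 1)
    (hB : IsASM B) :
    ∏ i, ∏ j, vertexWeight x y 0 ((Fin.cons σ fun _ => 0 : Fin (N + 1) → A) i)
      ((edgeStates B).2 i j.castSucc) ((edgeStates B).1 i.castSucc j)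
      ((edgeStates B).2 i j.succ) ((edgeStates B).1 i.succ j) =
    (1 - σ) ^ N * asmWeight x y z B := by
  simp only [vertexWeight_edgeStates x y σ hB, prod_mul_distrib]
  have e1 : ∏ i, ∏ j, (if B i j = -1 then x else 1) = x ^ numNeg B := by
    rw [← Fintype.prod_prod_type' fun i j => if B i j = -1 then x else 1, prod_ite]
    simp [numNeg]
  have e2 : ∏ i, ∏ j, (if ((edgeStates B).2 i j.castSucc = true ∧
      (edgeStates B).1 i.castSucc j = true) ∧ B i j ≠ -1 then y else 1) =
      y ^ (inv B - numNeg B).toNat := by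
    rw [← Fintype.prod_prod_type' fun i j => if ((edgeStates B).2 i j.castSucc = true ∧
      (edgeStates B).1 i.castSucc j = true) ∧ B i j ≠ -1 then y else 1, prod_ite,
      inv_sub_numNeg hB]
    simp
  have e3 : ∏ i : Fin (N + 1), ∏ j : Fin (N + 1), (if i = 0 then
      if (edgeStates B).2 i j.castSucc = true then 1 - σ else 1 else 1) =
      (1 - σ) ^ N * z ^ topZeros B := by
    rw [prod_eq_single 0 (fun i _ hi => by simp [hi]) (by simp)]
    simp only [if_true]
    rw [prod_ite, prod_const, prod_const_one, mul_one]
    have hN : (1 - σ) ^ N = (1 - σ) ^ topZeros B *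
        (1 - σ) ^ #{j : Fin (N + 1) | (edgeStates B).2 0 j.castSucc = true} := by
      rw [← pow_add, topZeros_add_card hB]
    rw [hN, mul_right_comm, ← mul_pow, mul_comm (1 - σ) z, hz, one_pow, one_mul]
  rw [e1, e2, e3, asmWeight]
  ring

theorem dwbc_eq_asmZ {A : Type*} [CommRing A] (x y z σ : A) (hz : z * (1 - σ) = 1) :
    dwbc x y (fun _ : Fin (N + 1) => 0) (List.ofFn (Fin.cons σ fun _ => 0 : Fin (N + 1) → A)) =
      (1 - σ) ^ N * asmZ (N + 1) x y z := by
  rw [dwbc_eq_sum_asm, asmZ, mul_sum]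
  refine sum_congr rfl fun B hB => prod_vertexWeight_eq x y z σ hz ?_
  simpa using hB

/-- The determinant formula for alternating sign matrices. -/
theorem asmZ_eq_det {K : Type*} [Field K] (x y : K) {z : K} (hz : z ≠ 0) (N : ℕ) :
    asmZ (N + 1) x y z = (Matrix.of fun m l : Fin (N + 1) =>
      PowerSeries.coeff l (pathSeries x y z (N + 1) 0 (m.1 + 1)) -
        if l.1 = m.1 + 1 then 1 else 0).det := by
  -- Each zero to the right of the top 1 has weight 1 - σ = z⁻¹, so the choice σ = 1 - z⁻¹ turns
  -- this count into z^t up to a global power.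
  have hσ : z * (1 - (1 - z⁻¹)) = 1 := by rw [sub_sub_cancel, mul_inv_cancel₀ hz]
  have h := dwbc_eq_asmZ (N := N) x y z (1 - z⁻¹) hσ
  rw [dwbc_zero_eq_det, det_numPoly_eq x y z hσ] at h
  refine (mul_left_cancel₀ (pow_ne_zero N ?_) h).symm
  rw [sub_sub_cancel]
  exact inv_ne_zero hz

end ASMWeight

/-! ### Lattice paths -/

section Paths

open PowerSeries

variable {K : Type*} [Field K] (x y z : K)

/-- The weight of a part `h` at position `m` of a row. -/
def stepWeight (n m h : ℕ) : K := if h = n then y * z else if h ≤ m then x else y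

theorem constantCoeff_pathSeries (n m h : ℕ) : constantCoeff (pathSeries x y z n m h) = 1 := by
  unfold pathSeries
  split_ifs <;> simp [moebiusNum, moebiusDen]

theorem pathSeries_zero {n : ℕ} (hn : n ≠ 0) (m : ℕ) : pathSeries x y z n m 0 = 1 := by
  simp [pathSeries, hn.symm]

/-- The difference counts rows with first part exactly h + 1; X marks that part and the remaining
row starts at position m + 1. The three cases of `stepWeight` rest on M = D + yX, 1 = D + xX and the
inverse of M - yzX. -/
theorem pathSeries_succ_sub {n m h : ℕ} (hm : m < n) (hh : h + 1 ≤ n) :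
    pathSeries x y z n m (h + 1) - pathSeries x y z n m h =
      X * (C (stepWeight x y z n m (h + 1)) * pathSeries x y z n (m + 1) (h + 1)) := by
  have hD := moebiusDen_mul_inv x
  have hR := num_sub_mul_inv x y z
  have hMD : moebiusNum x y = moebiusDen x + C y * X := by
    simp [moebiusNum, moebiusDen]
    ring
  have hone : (1 : K⟦X⟧) = moebiusDen x + C x * X := by
    simp [moebiusDen]
  rw [pathSeries, pathSeries, pathSeries, stepWeight, if_neg (show h ≠ n by omega)]
  set D := moebiusDen x
  set D' := D⁻¹
  by_cases h1 : h + 1 = n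
  · simp only [if_pos h1]
    obtain ⟨r, rfl⟩ : ∃ r, n = m + 1 + r := ⟨n - m - 1, by omega⟩
    have hh : h = m + r := by omega
    subst hh
    have e1 : m + 1 + r - m = r + 1 := by omega
    have e2 : m + 1 + r - (m + 1) = r := by omega
    have e3 : m + r - m = r := by omega
    rw [e1, e2, e3, min_eq_right (by omega), map_mul]
    rw [map_mul] at hR
    set M := moebiusNum x y
    set R := (M - C y * C z * X)⁻¹
    clear_value D D' M R
    linear_combination ((M * D') ^ r * D' ^ m) * ((M - C y * C z * X) * R * hD + hR)
  · simp only [if_neg h1]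
    by_cases h2 : h + 1 ≤ m
    · have e1 : h + 1 - m = 0 := by omega
      have e2 : h + 1 - (m + 1) = 0 := by omega
      have e3 : h - m = 0 := by omega
      rw [if_pos h2, e1, e2, e3, min_eq_left h2, min_eq_left (by omega), min_eq_left (by omega)]
      simp only [pow_zero, one_mul]
      clear_value D D'
      linear_combination D' ^ (h + 1) * hone + D' ^ h * hD
    · obtain ⟨r, rfl⟩ : ∃ r, h = m + r := ⟨h - m, by omega⟩
      have e1 : m + r + 1 - m = r + 1 := by omega
      have e2 : m + r + 1 - (m + 1) = r := by omega
      have e3 : m + r - m = r := by omega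
      rw [if_neg h2, e1, e2, e3, min_eq_right (by omega), min_eq_right (by omega),
        min_eq_right (by omega)]
      set M := moebiusNum x y
      clear_value D D' M
      linear_combination ((M * D') ^ r * D' ^ m) * (D' * hMD + hD)

theorem coeff_pathSeries_sub {n m lo h : ℕ} (hm : m < n) (hlo : lo ≤ h) (hh : h ≤ n) (k : ℕ) :
    coeff (k + 1) (pathSeries x y z n m h) - coeff (k + 1) (pathSeries x y z n m lo) =
      ∑ a ∈ Ioc lo h, stepWeight x y z n m a * coeff k (pathSeries x y z n (m + 1) a) := by
  induction h, hlo using Nat.le_induction with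
  | base => simp
  | succ h hlo ih =>
    have h1 := congrArg (coeff (k + 1)) (pathSeries_succ_sub x y z hm hh)
    rw [map_sub, coeff_succ_X_mul, coeff_C_mul] at h1
    rw [sum_Ioc_succ_top hlo, ← ih (by omega), ← h1]
    ring

/-- The lower bound for the part following `H`. -/
def prev {k : ℕ} (lo : ℕ) (H : Fin k → ℕ) (j : Fin k) : ℕ :=
  (Fin.cons lo H : Fin (k + 1) → ℕ) j.castSucc

/-- The sequences interlacing with `H`. -/
def interlacing {k : ℕ} (lo : ℕ) (H : Fin k → ℕ) : Finset (Fin k → ℕ) :=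
  Fintype.piFinset fun j => Ioc (prev lo H j) (H j)

theorem det_sum_columns {k : ℕ} {R : Type*} [CommRing R] (S : Fin k → Finset ℕ) (c : ℕ → R)
    (a : Fin k → ℕ → R) :
    (Matrix.of fun i j => ∑ h ∈ S j, c h * a i h).det =
      ∑ H ∈ Fintype.piFinset S, (∏ j, c (H j)) * (Matrix.of fun i j => a i (H j)).det := by
  rw [← Matrix.det_transpose]
  have := (Matrix.detRowAlternating (n := Fin k) (R := R)).toMultilinearMap.map_sum_finset
    (fun _ h => fun i => c h * a i h) S
  have h1 : (Matrix.of fun i j => ∑ h ∈ S j, c h * a i h).transpose =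
      fun j => ∑ h ∈ S j, fun i => c h * a i h := by
    ext j i
    simp [Finset.sum_apply]
  rw [h1]
  refine this.trans (sum_congr rfl fun H _ => ?_)
  have h2 := Matrix.det_mul_column (fun j => c (H j)) (Matrix.of fun i j => a i (H j)).transpose
  rw [Matrix.det_transpose] at h2
  rw [← h2]
  rfl

/-- The matrix of path generating functions with starts `H` at position `m` and ends `I`. -/
noncomputable def pathMatrix {k : ℕ} (n m : ℕ) (I H : Fin k → ℕ) : Matrix (Fin k) (Fin k) K :=
  .of fun i j => coeff (I i - m) (pathSeries x y z n m (H j))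

/-- A difference of adjacent columns is a sum over first parts between the two heights;
multilinearity in the columns turns the determinant into a sum over interlacing sequences. -/
theorem det_of_sub {k n m lo : ℕ} (I H : Fin k → ℕ) (hm : m < n) (hI : ∀ i, m < I i)
    (hH : Monotone (Fin.cons lo H : Fin (k + 1) → ℕ)) (hn : ∀ j, H j ≤ n) :
    (Matrix.of fun i j => coeff (I i - m) (pathSeries x y z n m (H j)) -
      coeff (I i - m) (pathSeries x y z n m (prev lo H j))).det =
    ∑ H' ∈ interlacing lo H, (∏ j, stepWeight x y z n m (H' j)) *
      (pathMatrix x y z n (m + 1) I H').det := by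
  unfold interlacing pathMatrix
  rw [← det_sum_columns _ (fun h => stepWeight x y z n m h)
    (fun i h => coeff (I i - (m + 1)) (pathSeries x y z n (m + 1) h))]
  congr 1
  ext i j
  obtain ⟨r, hr⟩ : ∃ r, I i = m + 1 + r := ⟨I i - (m + 1), by have := hI i; omega⟩
  have e1 : I i - m = r + 1 := by omega
  have e2 : I i - (m + 1) = r := by omega
  simp only [Matrix.of_apply, e1, e2]
  refine coeff_pathSeries_sub x y z hm ?_ (hn j) r
  simpa [prev] using hH (Fin.castSucc_lt_succ (i := j)).le

/-- No row ends at m, so all coefficients used have positive index. The series at height 0 is 1,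
hence subtracting it from the first column changes nothing. -/
theorem det_pathMatrix_of_lt {k n m : ℕ} (I H : Fin k → ℕ) (hm : m < n) (hI : ∀ i, m < I i)
    (hH : Monotone H) (hn : ∀ j, H j ≤ n) :
    (pathMatrix x y z n m I H).det = ∑ H' ∈ interlacing 0 H, (∏ j, stepWeight x y z n m (H' j)) *
      (pathMatrix x y z n (m + 1) I H').det := by
  have hH' : Monotone (Fin.cons 0 H : Fin (k + 1) → ℕ) := by
    intro i j hij
    cases i using Fin.cases with
    | zero => simp
    | succ i =>
      cases j using Fin.cases with
      | zero => simp at hij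
      | succ j => simpa using hH (Fin.succ_le_succ_iff.1 hij)
  rw [← det_of_sub x y z I H hm hI hH' hn]
  cases k with
  | zero => simp
  | succ k =>
    refine Matrix.det_eq_of_forall_col_eq_smul_add_pred (fun _ => 1) (fun i => ?_) fun i j => ?_
    · have h0 := pathSeries_zero x y z (show n ≠ 0 by omega) m
      simp [pathMatrix, prev, h0, coeff_one, (Nat.sub_pos_of_lt (hI i)).ne']
    · simp [pathMatrix, prev]

/-- The bottom row of the array ends at m, so the first matrix row consists of constant coefficients
1. Column differences reduce it to (1, 0, ..., 0), and h₀ survives as the lower bound for the next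
array row. -/
theorem det_pathMatrix_cons {k n m h₀ : ℕ} (I H : Fin k → ℕ) (hm : m < n) (hI : ∀ i, m < I i)
    (hH : Monotone (Fin.cons h₀ H : Fin (k + 1) → ℕ)) (hn : ∀ j, H j ≤ n) :
    (pathMatrix x y z n m (Fin.cons m I : Fin (k + 1) → ℕ) (Fin.cons h₀ H)).det =
      ∑ H' ∈ interlacing h₀ H, (∏ j, stepWeight x y z n m (H' j)) *
        (pathMatrix x y z n (m + 1) I H').det := by
  rw [← det_of_sub x y z I H hm hI hH hn]
  let Q : Matrix (Fin (k + 1)) (Fin (k + 1)) K := .of fun i j =>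
    pathMatrix x y z n m (Fin.cons m I : Fin (k + 1) → ℕ) (Fin.cons h₀ H) i j -
      Fin.cases 0 (fun j : Fin k => pathMatrix x y z n m (Fin.cons m I : Fin (k + 1) → ℕ)
        (Fin.cons h₀ H) i j.castSucc) j
  have h1 : (pathMatrix x y z n m (Fin.cons m I : Fin (k + 1) → ℕ) (Fin.cons h₀ H)).det = Q.det := by
    refine Matrix.det_eq_of_forall_col_eq_smul_add_pred (fun _ => 1) (fun i => ?_) fun i j => ?_
    · simp [Q]
    · simp [Q]
  have hrow : ∀ j, pathMatrix x y z n m (Fin.cons m I : Fin (k + 1) → ℕ) (Fin.cons h₀ H) 0 j = 1 := by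
    intro j
    simp [pathMatrix, constantCoeff_pathSeries]
  rw [h1, Matrix.det_succ_row_zero, Fin.sum_univ_succ, sum_eq_zero]
  · have hQ : Q 0 0 = 1 := by simp [Q, hrow]
    rw [hQ]
    simp only [Fin.val_zero, pow_zero, one_mul, add_zero]
    congr 1
  · intro j _
    have : Q 0 j.succ = 0 := by simp [Q, hrow]
    rw [this]
    ring

end Paths

/-! ### Enumeration of arrays of nonintersecting paths -/

section Arrays

theorem mem_interlacing {k lo : ℕ} {H H' : Fin k → ℕ} :
    H' ∈ interlacing lo H ↔ (∀ i, i.1 = 0 → lo < H' i) ∧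
      (∀ i j : Fin k, i.1 + 1 = j.1 → H i < H' j) ∧ ∀ j, H' j ≤ H j := by
  simp only [interlacing, Fintype.mem_piFinset, mem_Ioc]
  cases k with
  | zero => simp
  | succ k =>
    constructor
    · intro h
      refine ⟨fun i hi => ?_, fun i j hij => ?_, fun j => (h j).2⟩
      · obtain rfl : i = 0 := Fin.ext hi
        exact (h 0).1
      · obtain ⟨j, rfl⟩ := Fin.exists_succ_eq.2 (show j ≠ 0 by rintro rfl; simp at hij)
        obtain rfl : i = j.castSucc := Fin.ext (by simpa using hij)
        have := (h j.succ).1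
        simpa [prev] using this
    · rintro ⟨h1, h2, h3⟩ j
      refine ⟨?_, h3 j⟩
      cases j using Fin.cases with
      | zero => exact h1 0 rfl
      | succ j => simpa [prev] using h2 j.castSucc j.succ rfl

/-- Families of rows (the bottom row first) whose parts start at position `m`. Row `i` ends at
position `I i`, and its first part is at most `H i` and larger than the bounds of the rows
below. -/
structure IsArray {k : ℕ} (m : ℕ) (I H : Fin k → ℕ) (f : Fin k → List ℕ) : Prop where
  len : ∀ i, (f i).length + m = I i
  pos : ∀ i, ∀ t < (f i).length, 0 < (f i).getD t 0
  row : ∀ i t, t + 1 < (f i).length → (f i).getD (t + 1) 0 ≤ (f i).getD t 0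
  head_le : ∀ i, (f i).getD 0 0 ≤ H i
  lt_head : ∀ i j : Fin k, i.1 + 1 = j.1 → H i < (f j).getD 0 0
  col : ∀ i j : Fin k, i.1 + 1 = j.1 → ∀ t < (f i).length, (f i).getD t 0 < (f j).getD (t + 1) 0

/-- Once the heads h are removed they become the new bounds: `row` and `col` at position 0 turn into
`head_le` and `lt_head`. The default value 0 makes the strict inequalities of `lt_head` and `col`
also assert that the larger part exists. -/
theorem isArray_cons_iff {k m : ℕ} {I H h : Fin k → ℕ} {f : Fin k → List ℕ} :
    IsArray m I H (fun i => h i :: f i) ↔ h ∈ interlacing 0 H ∧ IsArray (m + 1) I h f := by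
  rw [mem_interlacing]
  constructor
  · intro hA
    refine ⟨⟨fun i _ => by simpa using hA.pos i 0, fun i j hij => by simpa using hA.lt_head i j hij,
      fun j => by simpa using hA.head_le j⟩, ⟨fun i => ?_, fun i t ht => ?_, fun i t ht => ?_,
      fun i => ?_, fun i j hij => ?_, fun i j hij t ht => ?_⟩⟩
    · have := hA.len i
      simp only [List.length_cons] at this
      omega
    · simpa using hA.pos i (t + 1) (by simpa using ht)
    · simpa using hA.row i (t + 1) (by simpa using ht)
    · rcases Nat.eq_zero_or_pos (f i).length with h0 | h0
      · simp [List.length_eq_zero_iff.1 h0]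
      · simpa using hA.row i 0 (by simpa using h0)
    · simpa using hA.col i j hij 0 (by simp)
    · simpa using hA.col i j hij (t + 1) (by simpa using ht)
  · rintro ⟨⟨h1, h2, h3⟩, hA⟩
    refine ⟨fun i => ?_, fun i t ht => ?_, fun i t ht => ?_, fun i => by simpa using h3 i,
      fun i j hij => by simpa using h2 i j hij, fun i j hij t ht => ?_⟩
    · have := hA.len i
      simp only [List.length_cons]
      omega
    · cases t with
      | zero =>
        rw [List.getD_cons_zero]
        rcases Nat.eq_zero_or_pos i.1 with h0 | h0
        · exact h1 i h0
        · have := h2 ⟨i.1 - 1, by omega⟩ i (by simp; omega)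
          omega
      | succ t => simpa using hA.pos i t (by simpa using ht)
    · cases t with
      | zero => simpa using hA.head_le i
      | succ t => simpa using hA.row i t (by simpa using ht)
    · cases t with
      | zero => simpa using hA.lt_head i j hij
      | succ t => simpa using hA.col i j hij t (by simpa using ht)

theorem isArray_cons_nil_iff {k m h₀ : ℕ} {I H h : Fin k → ℕ} {f : Fin k → List ℕ} :
    IsArray m (Fin.cons m I : Fin (k + 1) → ℕ) (Fin.cons h₀ H) (Fin.cons [] fun i => h i :: f i) ↔
      h ∈ interlacing h₀ H ∧ IsArray (m + 1) I h f := by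
  rw [mem_interlacing]
  constructor
  · intro hA
    refine ⟨⟨fun i hi => ?_, fun i j hij => ?_, fun j => by simpa using hA.head_le j.succ⟩,
      ⟨fun i => ?_, fun i t ht => ?_, fun i t ht => ?_, fun i => ?_, fun i j hij => ?_,
      fun i j hij t ht => ?_⟩⟩
    · simpa using hA.lt_head 0 i.succ (by simp [hi])
    · simpa using hA.lt_head i.succ j.succ (by simp [hij])
    · have := hA.len i.succ
      simp only [Fin.cons_succ, List.length_cons] at this
      omega
    · simpa using hA.pos i.succ (t + 1) (by simpa using ht)
    · simpa using hA.row i.succ (t + 1) (by simpa using ht)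
    · rcases Nat.eq_zero_or_pos (f i).length with h0 | h0
      · simp [List.length_eq_zero_iff.1 h0]
      · simpa using hA.row i.succ 0 (by simpa using h0)
    · simpa using hA.col i.succ j.succ (by simp [hij]) 0 (by simp)
    · simpa using hA.col i.succ j.succ (by simp [hij]) (t + 1) (by simpa using ht)
  · rintro ⟨⟨h1, h2, h3⟩, hA⟩
    refine ⟨fun i => ?_, fun i t ht => ?_, fun i t ht => ?_, fun i => ?_, fun i j hij => ?_,
      fun i j hij t ht => ?_⟩
    · cases i using Fin.cases with
      | zero => simp
      | succ i =>
        have := hA.len i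
        simp only [Fin.cons_succ, List.length_cons]
        omega
    · cases i using Fin.cases with
      | zero => simp at ht
      | succ i =>
        cases t with
        | zero =>
          rw [Fin.cons_succ, List.getD_cons_zero]
          rcases Nat.eq_zero_or_pos i.1 with h0 | h0
          · exact (Nat.zero_le _).trans_lt (h1 i h0)
          · have := h2 ⟨i.1 - 1, by omega⟩ i (by simp; omega)
            omega
        | succ t => simpa using hA.pos i t (by simpa using ht)
    · cases i using Fin.cases with
      | zero => simp at ht
      | succ i =>
        cases t with
        | zero => simpa using hA.head_le i
        | succ t => simpa using hA.row i t (by simpa using ht)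
    · cases i using Fin.cases with
      | zero => simp
      | succ i => simpa using h3 i
    · cases j using Fin.cases with
      | zero => simp at hij
      | succ j =>
        cases i using Fin.cases with
        | zero => simpa using h1 j (by simpa using hij.symm)
        | succ i => simpa using h2 i j (by simpa using hij)
    · cases j using Fin.cases with
      | zero => simp at hij
      | succ j =>
        cases i using Fin.cases with
        | zero => simp at ht
        | succ i =>
          have hij' : i.1 + 1 = j.1 := by simpa using hij
          cases t with
          | zero => simpa using hA.lt_head i j hij'
          | succ t => simpa using hA.col i j hij' t (by simpa using ht)

theorem strictMono_of_mem_interlacing {k lo : ℕ} {H H' : Fin k → ℕ} (h : H' ∈ interlacing lo H) :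
    StrictMono H' := by
  rw [mem_interlacing] at h
  cases k with
  | zero => exact fun i => i.elim0
  | succ k =>
    rw [Fin.strictMono_iff_lt_succ]
    exact fun i => (h.2.2 _).trans_lt (h.2.1 _ _ rfl)

variable {K : Type*} [Field K] (x y z : K)

/-- The weight of a row whose parts start at position `m`. -/
def rowWeight (n m : ℕ) (l : List ℕ) : K :=
  ∏ t ∈ range l.length, stepWeight x y z n (m + t) (l.getD t 0)

theorem rowWeight_nil (n m : ℕ) : rowWeight x y z n m [] = 1 := rfl

theorem rowWeight_cons (n m h : ℕ) (l : List ℕ) :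
    rowWeight x y z n m (h :: l) = stepWeight x y z n m h * rowWeight x y z n (m + 1) l := by
  rw [rowWeight, List.length_cons, prod_range_succ', mul_comm, rowWeight]
  congr 1
  refine prod_congr rfl fun t _ => ?_
  rw [List.getD_cons_succ]
  congr 1
  ring

/-- Summation over a set of pairs, by the first component. -/
theorem sum_eq_sum_sum_of_mem_iff {α β γ M : Type*} [DecidableEq α] [DecidableEq β] [DecidableEq γ]
    [AddCommMonoid M] (F : Finset γ) (S : Finset α) (P : α → β → Prop) (e : α → β → γ)
    (a : γ → α) (b : γ → β) (ha : ∀ p q, a (e p q) = p) (hb : ∀ p q, b (e p q) = q)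
    (hF : ∀ c ∈ F, e (a c) (b c) = c) (hmem : ∀ p q, e p q ∈ F ↔ p ∈ S ∧ P p q) (w : γ → M) :
    ∃ F' : α → Finset β, (∀ p ∈ S, ∀ q, q ∈ F' p ↔ P p q) ∧
      ∑ c ∈ F, w c = ∑ p ∈ S, ∑ q ∈ F' p, w (e p q) := by
  refine ⟨fun p => (F.filter fun c => a c = p).image b, fun p hp q => ?_, ?_⟩
  · simp only [mem_image, mem_filter]
    constructor
    · rintro ⟨c, ⟨hc, rfl⟩, rfl⟩
      rw [← hF c hc, hmem] at hc
      exact hc.2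
    · exact fun h => ⟨e p q, ⟨(hmem p q).2 ⟨hp, h⟩, ha p q⟩, hb p q⟩
  · rw [← sum_fiberwise_of_maps_to (g := a) (t := S)]
    · refine sum_congr rfl fun p _ => ?_
      rw [sum_image]
      · refine sum_congr rfl fun c hc => ?_
        rw [mem_filter] at hc
        rw [← hc.2, hF c hc.1]
      · intro c hc d hd hcd
        simp only [coe_filter, Set.mem_ofPred_eq] at hc hd
        rw [← hF c hc.1, ← hF d hd.1, hc.2, hd.2, hcd]
    · intro c hc
      rw [← hF c hc, hmem] at hc
      exact hc.1

/-- The enumeration of arrays by a determinant. -/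
theorem sum_rowWeight_eq_det {k n : ℕ} (N m : ℕ) (I H : Fin k → ℕ) (hI : StrictMono I)
    (hH : StrictMono H) (hn : ∀ j, H j ≤ n) (hIn : ∀ i, I i < n) (hm : ∀ i, m ≤ I i)
    (hN : ∀ i, I i < m + N) (F : Finset (Fin k → List ℕ)) (hF : ∀ f, f ∈ F ↔ IsArray m I H f) :
    ∑ f ∈ F, ∏ i, rowWeight x y z n m (f i) = (pathMatrix x y z n m I H).det := by
  induction N generalizing k m with
  | zero =>
    cases k with
    | zero =>
      obtain rfl : F = {fun i => i.elim0} := by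
        ext f
        simp only [hF, mem_singleton]
        refine ⟨fun _ => Subsingleton.elim _ _, fun _ => ⟨?_, ?_, ?_, ?_, ?_, ?_⟩⟩ <;>
          exact fun i => i.elim0
      simp
    | succ k =>
      have h1 := hm 0
      have h2 := hN 0
      omega
  | succ N ih =>
    cases k with
    | zero =>
      obtain rfl : F = {fun i => i.elim0} := by
        ext f
        simp only [hF, mem_singleton]
        refine ⟨fun _ => Subsingleton.elim _ _, fun _ => ⟨?_, ?_, ?_, ?_, ?_, ?_⟩⟩ <;>
          exact fun i => i.elim0
      simp
    | succ k =>
      have hmn : m < n := (hm 0).trans_lt (hIn 0)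
      -- Since I is strictly increasing, only the bottom row can end at position m; it is then empty
      -- and is dropped.
      rcases (hm 0).eq_or_lt with h0 | h0
      · obtain ⟨I, rfl⟩ : ∃ I', I = (Fin.cons m I' : Fin (k + 1) → ℕ) :=
          ⟨Fin.tail I, by rw [h0, Fin.cons_self_tail]⟩
        obtain ⟨h₀, H, rfl⟩ : ∃ h₀ H', H = (Fin.cons h₀ H' : Fin (k + 1) → ℕ) :=
          ⟨H 0, Fin.tail H, (Fin.cons_self_tail H).symm⟩
        have hmI : ∀ i, m < I i := fun i => by simpa using hI (Fin.succ_pos i)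
        have hI' : StrictMono I := fun i j hij => by simpa using hI (Fin.succ_lt_succ_iff.2 hij)
        have hn' : ∀ j, H j ≤ n := fun j => hn j.succ
        have hIn' : ∀ i, I i < n := fun i => hIn i.succ
        have hN' : ∀ i, I i < m + 1 + N := fun i => by have := hN i.succ; simp at this; omega
        rw [det_pathMatrix_cons x y z I H hmn hmI hH.monotone hn']
        obtain ⟨F', hF', hsum⟩ := sum_eq_sum_sum_of_mem_iff F (interlacing h₀ H)
          (fun h f => IsArray (m + 1) I h f)
          (fun h f => (Fin.cons [] fun i => h i :: f i : Fin (k + 1) → List ℕ))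
          (fun f i => (f i.succ).headD 0) (fun f i => (f i.succ).tail) (by simp) (by simp)
          (fun f hf => by
            rw [hF] at hf
            ext1 i
            cases i using Fin.cases with
            | zero =>
              have := hf.len 0
              simp only [Fin.cons_zero, Nat.add_eq_right, List.length_eq_zero_iff] at this
              simp [this]
            | succ i =>
              have h1 := hf.len i.succ
              have h2 := hmI i
              simp only [Fin.cons_succ] at h1 ⊢
              cases hfi : f i.succ with
              | nil => rw [hfi] at h1; simp at h1; omega
              | cons a l => rfl)
          (fun h f => by rw [hF, isArray_cons_nil_iff])
          (fun f => ∏ i, rowWeight x y z n m (f i))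
        rw [hsum]
        refine sum_congr rfl fun h hh => ?_
        rw [← ih (m + 1) I h hI' (strictMono_of_mem_interlacing hh)
          (fun j => ((mem_interlacing.1 hh).2.2 j).trans (hn' j)) hIn' hmI hN' (F' h) (hF' h hh),
          mul_sum]
        refine sum_congr rfl fun f _ => ?_
        rw [Fin.prod_univ_succ]
        simp only [Fin.cons_zero, Fin.cons_succ, rowWeight_nil, rowWeight_cons, one_mul,
          prod_mul_distrib]
      · have hmI : ∀ i, m < I i := fun i => h0.trans_le (hI.monotone (Fin.zero_le i))
        have hN' : ∀ i, I i < m + 1 + N := fun i => by have := hN i; omega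
        rw [det_pathMatrix_of_lt x y z I H hmn hmI hH.monotone hn]
        obtain ⟨F', hF', hsum⟩ := sum_eq_sum_sum_of_mem_iff F (interlacing 0 H)
          (fun h f => IsArray (m + 1) I h f)
          (fun h f => fun i => h i :: f i)
          (fun f i => (f i).headD 0) (fun f i => (f i).tail) (by simp) (by simp)
          (fun f hf => by
            rw [hF] at hf
            ext1 i
            have h1 := hf.len i
            have h2 := hmI i
            cases hfi : f i with
            | nil => rw [hfi] at h1; simp at h1; omega
            | cons a l => simp [hfi])
          (fun h f => by rw [hF, isArray_cons_iff])
          (fun f => ∏ i, rowWeight x y z n m (f i))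
        rw [hsum]
        refine sum_congr rfl fun h hh => ?_
        rw [← ih (m + 1) I h hI (strictMono_of_mem_interlacing hh)
          (fun j => ((mem_interlacing.1 hh).2.2 j).trans (hn j)) hIn hmI hN' (F' h) (hF' h hh),
          mul_sum]
        refine sum_congr rfl fun f _ => ?_
        simp only [rowWeight_cons, prod_mul_distrib]

end Arrays

/-! ### Expansion of a determinant with a shift -/

section DetExpansion

variable {R : Type*} [CommRing R]

/-- Multilinearity in the rows: for each s the rows outside s are taken from the diagonal matrix,
which makes the determinant block triangular. -/
theorem det_add_diagonal {ι : Type*} [Fintype ι] [DecidableEq ι] (A : Matrix ι ι R) (d : ι → R) :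
    (A + Matrix.diagonal d).det = ∑ s : Finset ι, (∏ i ∈ sᶜ, d i) *
      (A.submatrix (Subtype.val : {i // i ∈ s} → ι) Subtype.val).det := by
  refine ((Matrix.detRowAlternating (n := ι) (R := R)).map_add_univ A (Matrix.diagonal d)).trans
    (sum_congr rfl fun s _ => ?_)
  let Q : Matrix ι ι R := s.piecewise A (Matrix.diagonal d)
  have hin : ∀ i ∈ s, ∀ j, Q i j = A i j := fun i hi j =>
    congrFun (piecewise_eq_of_mem s A (Matrix.diagonal d) hi) j
  have hout : ∀ i ∉ s, ∀ j, Q i j = Matrix.diagonal d i j := fun i hi j =>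
    congrFun (piecewise_eq_of_notMem s A (Matrix.diagonal d) hi) j
  have e1 : (Q.toSquareBlockProp fun i => ¬ i ∈ s).det = ∏ i ∈ sᶜ, d i := by
    have h : Q.toSquareBlockProp (fun i => ¬ i ∈ s) =
        Matrix.diagonal fun i : {i // ¬ i ∈ s} => d i := by
      ext i j
      rw [Matrix.toSquareBlockProp_def, Matrix.of_apply, hout i i.2]
      simp [Matrix.diagonal_apply, Subtype.ext_iff]
    rw [h, Matrix.det_diagonal]
    exact (prod_subtype sᶜ (fun i => mem_compl) d).symm
  have e2 : Q.toSquareBlockProp (fun i => i ∈ s) =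
      A.submatrix (Subtype.val : {i // i ∈ s} → ι) Subtype.val := by
    ext i j
    exact hin i i.2 j
  have e3 := Matrix.twoBlockTriangular_det Q (fun i => i ∈ s) fun i hi j hj => by
    rw [hout i hi, Matrix.diagonal_apply_ne]
    rintro rfl
    exact hi hj
  rw [e1, e2, mul_comm] at e3
  refine e3.trans ?_
  congr!

theorem finRotate_symm_zero (r : ℕ) : (finRotate (r + 1)).symm 0 = Fin.last r := by
  rw [Equiv.symm_apply_eq, finRotate_last]

theorem finRotate_symm_succ {r : ℕ} (a : Fin r) :
    (finRotate (r + 1)).symm a.succ = a.castSucc := by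
  rw [Equiv.symm_apply_eq, finRotate_apply, Fin.coeSucc_eq_succ]

theorem det_submatrix_finRotate_symm {r : ℕ} (Q : Matrix (Fin (r + 1)) (Fin (r + 1)) R) :
    (Q.submatrix id (finRotate (r + 1)).symm).det = (-1) ^ r * Q.det := by
  rw [Matrix.det_permute', Equiv.Perm.sign_symm, sign_finRotate]
  simp

/-- The row indices `0` and `s + 1` for `s ∈ S`. -/
def rowSel {N : ℕ} (S : Finset (Fin N)) : Fin (#S + 1) → Fin (N + 1) :=
  Fin.cons 0 fun a => (S.orderEmbOfFin rfl a).succ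

/-- The column indices `s` for `s ∈ S` and the last one. -/
def colSel {N : ℕ} (S : Finset (Fin N)) : Fin (#S + 1) → Fin (N + 1) :=
  Fin.snoc (fun a => (S.orderEmbOfFin rfl a).castSucc) (Fin.last N)

variable {N : ℕ}

theorem rowSel_strictMono (S : Finset (Fin N)) : StrictMono (rowSel S) := by
  intro a b hab
  cases b using Fin.cases with
  | zero => simp at hab
  | succ b =>
    cases a using Fin.cases with
    | zero => simp [rowSel]
    | succ a =>
      simpa [rowSel] using hab

theorem colSel_strictMono (S : Finset (Fin N)) : StrictMono (colSel S) := by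
  intro a b hab
  rcases Fin.eq_castSucc_or_eq_last a with ⟨a, rfl⟩ | rfl
  · rcases Fin.eq_castSucc_or_eq_last b with ⟨b, rfl⟩ | rfl
    · simpa [colSel] using hab
    · simp [colSel, Fin.castSucc_lt_last]
  · exact absurd hab (Fin.le_last b).not_gt

theorem mem_range_rowSel (S : Finset (Fin N)) (i : Fin (N + 1)) :
    (∃ a, rowSel S a = i) ↔ i ∈ insert 0 (S.map (Fin.succEmb N)) := by
  rw [mem_insert, mem_map, Fin.exists_fin_succ]
  have hr : ∀ t, t ∈ S ↔ ∃ a, S.orderEmbOfFin rfl a = t := fun t => by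
    rw [← mem_coe, ← range_orderEmbOfFin S rfl, Set.mem_range]
  constructor
  · rintro (h | ⟨a, h⟩)
    · exact .inl h.symm
    · exact .inr ⟨_, S.orderEmbOfFin_mem rfl a, h⟩
  · rintro (h | ⟨t, ht, h⟩)
    · exact .inl h.symm
    · obtain ⟨a, rfl⟩ := (hr t).1 ht
      exact .inr ⟨a, h⟩

theorem det_submatrix_insert (M : Matrix (Fin (N + 1)) (Fin (N + 1)) R) (S : Finset (Fin N)) :
    ((M.submatrix id (finRotate (N + 1)).symm).submatrix
      (Subtype.val : {i // i ∈ insert 0 (S.map (Fin.succEmb N))} → Fin (N + 1)) Subtype.val).det =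
    (-1) ^ #S * (M.submatrix (rowSel S) (colSel S)).det := by
  let e : Fin (#S + 1) ≃ {i // i ∈ insert 0 (S.map (Fin.succEmb N))} :=
    Equiv.ofBijective (fun a => ⟨rowSel S a, (mem_range_rowSel S _).1 ⟨a, rfl⟩⟩)
      ⟨fun a b h => (rowSel_strictMono S).injective (Subtype.ext_iff.1 h), fun i => by
        obtain ⟨a, ha⟩ := (mem_range_rowSel S i.1).2 i.2
        exact ⟨a, Subtype.ext ha⟩⟩
  rw [← Matrix.det_submatrix_equiv_self e, ← det_submatrix_finRotate_symm]
  congr 1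
  ext a b
  have h1 : ((finRotate (N + 1)).symm (rowSel S b)) = colSel S ((finRotate (#S + 1)).symm b) := by
    cases b using Fin.cases with
    | zero => simp only [rowSel, colSel, Fin.cons_zero, finRotate_symm_zero, Fin.snoc_last]
    | succ b => simp only [rowSel, colSel, Fin.cons_succ, finRotate_symm_succ, Fin.snoc_castSucc]
  simp only [Matrix.submatrix_apply, id]
  rw [← h1]
  rfl

/-- A cyclic rotation of the columns turns the subtracted shift into the diagonal matrix with
entries 0, -1, ..., -1, so principal minors can be used. The signs (-1)^N of the rotation, (-1)^#S
of the rotated minor and (-1)^(N - #S) of the diagonal entries cancel. -/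
theorem det_sub_shift (M : Matrix (Fin (N + 1)) (Fin (N + 1)) R) :
    (Matrix.of fun l m : Fin (N + 1) => M l m - if l.1 = m.1 + 1 then 1 else 0).det =
      ∑ S : Finset (Fin N), (M.submatrix (rowSel S) (colSel S)).det := by
  have hsq : ∀ r : ℕ, (-1 : R) ^ r * (-1) ^ r = 1 := fun r => by
    rw [← mul_pow]
    simp
  let d : Fin (N + 1) → R := Fin.cons 0 fun _ => -1
  have h1 : (Matrix.of fun l m : Fin (N + 1) => M l m - if l.1 = m.1 + 1 then 1 else 0).submatrix id
      (finRotate (N + 1)).symm = M.submatrix id (finRotate (N + 1)).symm + Matrix.diagonal d := by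
    ext l m
    simp only [Matrix.submatrix_apply, Matrix.of_apply, Matrix.add_apply, id, Matrix.diagonal_apply,
      sub_eq_add_neg]
    congr 1
    cases m using Fin.cases with
    | zero =>
      have := l.2
      rw [finRotate_symm_zero, Fin.val_last, if_neg (by omega)]
      by_cases hl : l = 0 <;> simp [hl, d]
    | succ m =>
      rw [finRotate_symm_succ]
      by_cases hl : l = m.succ
      · simp [hl, d]
      · rw [if_neg, if_neg hl, neg_zero]
        intro h
        exact hl (Fin.ext (by simpa using h))
  have h2 := congrArg Matrix.det h1
  rw [det_submatrix_finRotate_symm, det_add_diagonal] at h2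
  have h3 : ∑ S : Finset (Fin N), (-1) ^ N * (M.submatrix (rowSel S) (colSel S)).det =
      ∑ s : Finset (Fin (N + 1)), (∏ i ∈ sᶜ, d i) * ((M.submatrix id
        (finRotate (N + 1)).symm).submatrix (Subtype.val : {i // i ∈ s} → Fin (N + 1))
          Subtype.val).det := by
    refine sum_of_injOn (fun S => insert 0 (S.map (Fin.succEmb N))) ?_ (by simp) ?_ ?_
    · intro S _ S' _ h
      ext t
      have := congrArg (t.succ ∈ ·) h
      simpa [Fin.succ_ne_zero] using this
    -- Index sets without 0 contribute nothing, because the diagonal entry at 0 is 0.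
    · intro s _ hs
      have h0 : (0 : Fin (N + 1)) ∉ s := by
        intro h0
        refine hs ⟨univ.filter fun t => t.succ ∈ s, by simp, ?_⟩
        ext i
        cases i using Fin.cases with
        | zero => simp [h0]
        | succ i => simp [Fin.succ_ne_zero]
      rw [prod_eq_zero (mem_compl.2 h0) (by simp [d]), zero_mul]
    · intro S _
      rw [det_submatrix_insert]
      have hc : (insert 0 (S.map (Fin.succEmb N)))ᶜ = Sᶜ.map (Fin.succEmb N) := by
        ext i
        cases i using Fin.cases <;> simp [Fin.succ_ne_zero]
      have hd : ∏ i ∈ (insert 0 (S.map (Fin.succEmb N)))ᶜ, d i = (-1) ^ (N - #S) := by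
        rw [hc, prod_map]
        simp [d, card_compl]
      have hle : #S ≤ N := by simpa using card_le_univ S
      rw [hd, ← mul_assoc, ← pow_add, Nat.sub_add_cancel hle]
  rw [← h3, ← mul_sum] at h2
  have h4 := congrArg ((-1) ^ N * ·) h2
  simpa only [← mul_assoc, hsq, one_mul] using h4

end DetExpansion

/-! ### The determinant of descending plane partitions -/

section DPP

variable {N : ℕ}

/-- The height bound of a row is the length of the row above it. This identification encodes λ_i <
a_{i,i} ≤ λ_{i-1} in `lt_head` and `head_le`. -/
theorem colSel_eq_rowSel (S : Finset (Fin N)) (i j : Fin (#S + 1)) (h : i.1 + 1 = j.1) :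
    (colSel S i).1 + 1 = (rowSel S j).1 := by
  obtain ⟨j, rfl⟩ := Fin.exists_succ_eq.2 (show j ≠ 0 by rintro rfl; simp at h)
  obtain rfl : i = j.castSucc := Fin.ext (by simpa using h)
  simp [colSel, rowSel]

theorem rowSel_zero (S : Finset (Fin N)) : rowSel S 0 = 0 := rfl

theorem colSel_last (S : Finset (Fin N)) : colSel S (Fin.last #S) = Fin.last N := by simp [colSel]

theorem rowLen_lt_rowLen {A : List (List ℕ)} (hA : IsDPP A) {i j : ℕ} (hij : i < j)
    (hj : j < A.length) : rowLen A j < rowLen A i := by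
  induction j, hij using Nat.le_induction with
  | base =>
    have := hA.rowEnd_le i hj
    simp only [rowEnd, Nat.succ_eq_add_one] at this ⊢
    omega
  | succ j hij ih =>
    have := hA.rowEnd_le j hj
    have := ih (by omega)
    simp only [rowEnd] at *
    omega

theorem rowLen_lt_order {n : ℕ} {A : List (List ℕ)} (hA : IsDPP A) (hn : HasOrder n A) {i : ℕ}
    (hi : i < A.length) : rowLen A i < n :=
  (hA.rowLen_lt i hi).trans_le (hn i hi 0 (hA.row_nonempty i hi))

/-- The set of row lengths, diminished by one. -/
def lenSet (N : ℕ) (A : List (List ℕ)) : Finset (Fin N) :=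
  univ.filter fun s => ∃ i < A.length, rowLen A i = s.1 + 1

theorem card_lenSet {A : List (List ℕ)} (hA : IsDPP A) (hn : HasOrder (N + 1) A) :
    #(lenSet N A) = A.length := by
  have h : (lenSet N A).image Fin.val = (range A.length).image fun i => rowLen A i - 1 := by
    ext t
    simp only [lenSet, mem_image, mem_filter, mem_univ, true_and, mem_range]
    constructor
    · rintro ⟨s, ⟨i, hi, h⟩, rfl⟩
      exact ⟨i, hi, by omega⟩
    · rintro ⟨i, hi, rfl⟩
      have h1 := hA.row_nonempty i hi
      have h2 := rowLen_lt_order hA hn hi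
      exact ⟨⟨rowLen A i - 1, by omega⟩, ⟨i, hi, by simp; omega⟩, rfl⟩
  rw [← card_image_of_injective _ Fin.val_injective, h, card_image_of_injOn, card_range]
  intro i hi j hj hij
  simp only [coe_range, Set.mem_Iio] at hi hj
  have h1 := hA.row_nonempty i hi
  have h2 := hA.row_nonempty j hj
  simp only at hij
  rcases lt_trichotomy i j with h | h | h
  · have := rowLen_lt_rowLen hA h hj
    omega
  · exact h
  · have := rowLen_lt_rowLen hA h hi
    omega

theorem rowLen_eq_rowSel {A : List (List ℕ)} (hA : IsDPP A) (hn : HasOrder (N + 1) A)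
    {S : Finset (Fin N)} (hS : lenSet N A = S) (a : Fin (#S + 1)) :
    rowLen A (#S - a.1) = rowSel S a := by
  have hc : #S = A.length := hS ▸ card_lenSet hA hn
  cases a using Fin.cases with
  | zero => simp [rowSel_zero, rowLen, hc]
  | succ b =>
    have hlt : ∀ b : Fin #S, #S - (b.1 + 1) < A.length := fun b => by have := b.2; omega
    let f : Fin #S → Fin N := fun b => ⟨rowLen A (#S - (b.1 + 1)) - 1, by
      have h1 := hA.row_nonempty _ (hlt b)
      have h2 := rowLen_lt_order hA hn (hlt b)
      omega⟩
    -- Row lengths strictly decrease downwards, so read from the bottom they are the increasing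
    -- enumeration of S, shifted by one.
    have hf : f = S.orderEmbOfFin rfl := by
      refine orderEmbOfFin_unique rfl (fun b => ?_) fun b c hbc => ?_
      · rw [← hS]
        simp only [lenSet, mem_filter, mem_univ, true_and]
        have h1 := hA.row_nonempty _ (hlt b)
        exact ⟨_, hlt b, by simp only [f]; omega⟩
      · have h1 := hA.row_nonempty _ (hlt b)
        have h2 := hA.row_nonempty _ (hlt c)
        have h3 : b.1 < c.1 := hbc
        have h4 := rowLen_lt_rowLen hA (i := #S - (c.1 + 1)) (j := #S - (b.1 + 1))
          (by have := c.2; omega) (hlt b)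
        simp only [f, Fin.lt_def]
        omega
    have h1 := hA.row_nonempty _ (hlt b)
    simp only [rowSel, Fin.cons_succ, ← hf, Fin.val_succ, f]
    omega

/-- The rows of `A`, the bottom row first, preceded by an empty row. -/
def bottomFirst (r : ℕ) (A : List (List ℕ)) (a : Fin (r + 1)) : List ℕ := A.getD (r - a.1) []

/-- The added empty row has length 0 and absorbs the index 0 of `rowSel`; the bound N + 1 of the top
row comes from the last index of `colSel` and expresses the order. -/
theorem isArray_bottomFirst {A : List (List ℕ)} (hA : IsDPP A) (hn : HasOrder (N + 1) A)
    {S : Finset (Fin N)} (hS : lenSet N A = S) :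
    IsArray 0 (fun a => (rowSel S a).1) (fun a => (colSel S a).1 + 1) (bottomFirst #S A) := by
  have hc : #S = A.length := hS ▸ card_lenSet hA hn
  have hlen := rowLen_eq_rowSel hA hn hS
  have hpos : ∀ (a : Fin (#S + 1)) t, t < rowLen A (#S - a.1) → #S - a.1 < A.length := by
    intro a t ht
    rcases Nat.eq_zero_or_pos a.1 with h | h
    · obtain rfl : a = 0 := Fin.ext h
      rw [hlen, rowSel_zero] at ht
      simp at ht
    · have := a.2
      omega
  refine ⟨fun a => hlen a, fun a t ht => hA.part_pos _ (hpos a t ht) t ht,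
    fun a t ht => hA.row_le _ (hpos a _ ht) t ht, fun a => ?_, fun a b hab => ?_,
    fun a b hab t ht => ?_⟩
  · change part A (#S - a.1) 0 ≤ _
    rcases Fin.eq_castSucc_or_eq_last a with ⟨a, rfl⟩ | rfl
    · rw [colSel_eq_rowSel S a.castSucc a.succ rfl, ← hlen]
      rcases Nat.eq_zero_or_pos a.1 with h | h
      · simp [part, h, hc]
      · have := a.2
        have e : #S - a.castSucc.1 = #S - a.succ.1 + 1 := by simp; omega
        rw [e]
        exact hA.le_rowLen _ (by simp; omega)
    · rw [colSel_last, Fin.val_last, Fin.val_last, Nat.sub_self]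
      rcases Nat.eq_zero_or_pos A.length with h | h
      · simp [part, List.length_eq_zero_iff.1 h]
      · exact hn 0 h 0 (hA.row_nonempty 0 h)
  · change _ < part A (#S - b.1) 0
    rw [colSel_eq_rowSel S a b hab, ← hlen]
    exact hA.rowLen_lt _ (by have := b.2; omega)
  · change part A (#S - a.1) t < part A (#S - b.1) (t + 1)
    have h1 := hpos a t ht
    have h2 := b.2
    have e : #S - a.1 = #S - b.1 + 1 := by omega
    change t < rowLen A (#S - a.1) at ht
    rw [e] at ht h1 ⊢
    exact hA.col_lt _ h1 t ht

theorem exists_dpp_of_isArray {S : Finset (Fin N)} {f : Fin (#S + 1) → List ℕ}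
    (hf : IsArray 0 (fun a => (rowSel S a).1) (fun a => (colSel S a).1 + 1) f) :
    ∃ A, (IsDPP A ∧ HasOrder (N + 1) A) ∧ lenSet N A = S ∧ bottomFirst #S A = f := by
  let A : List (List ℕ) := List.ofFn fun b : Fin #S => f b.rev.succ
  have hl : A.length = #S := by simp [A]
  have hget : ∀ i (hi : i < A.length), A.getD i [] = f ⟨#S - i, by omega⟩ := by
    intro i hi
    rw [List.getD_eq_getElem _ _ hi]
    simp only [A, List.getElem_ofFn]
    congr 1
    ext
    simp [Fin.val_rev]
    omega
  have hlen : ∀ i (hi : i < A.length), rowLen A i = rowSel S ⟨#S - i, by omega⟩ := by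
    intro i hi
    rw [rowLen, hget i hi]
    exact hf.len _
  have hpart : ∀ i (hi : i < A.length) m, part A i m = (f ⟨#S - i, by omega⟩).getD m 0 := by
    intro i hi m
    rw [part, hget i hi]
  have hanti : ∀ a t, t < (f a).length → (f a).getD t 0 ≤ (f a).getD 0 0 := by
    intro a t
    induction t with
    | zero => exact fun _ => le_rfl
    | succ t ih => exact fun h => (hf.row a t h).trans (ih (by omega))
  have hdpp : IsDPP A := by
    refine ⟨fun i hi => ?_, fun i hi m hm => ?_, fun i hi => ?_, fun i hi m hm => ?_,
      fun i hi m hm => ?_, fun i hi => ?_, fun i hi => ?_⟩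
    · rw [hlen i hi]
      exact (Nat.zero_le _).trans_lt (Fin.lt_def.1 (rowSel_strictMono S
        (show (0 : Fin (#S + 1)) < _ by rw [Fin.lt_def]; simp; omega)))
    · rw [hpart i hi]
      rw [rowLen, hget i hi] at hm
      exact hf.pos _ m hm
    · have := Fin.lt_def.1 (rowSel_strictMono S (show (⟨#S - (i + 1), by omega⟩ : Fin (#S + 1)) <
        ⟨#S - i, by omega⟩ by rw [Fin.lt_def]; simp; omega))
      rw [rowEnd, rowEnd, hlen _ hi, hlen i (by omega)]
      omega
    · rw [hpart i hi, hpart i hi]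
      rw [rowLen, hget i hi] at hm
      exact hf.row _ m hm
    · rw [hpart _ hi, hpart i (by omega)]
      rw [rowLen, hget _ hi] at hm
      exact hf.col _ _ (by simp; omega) m hm
    · rw [hpart i hi, hlen i hi, ← colSel_eq_rowSel S ⟨#S - (i + 1), by omega⟩ _ (by simp; omega)]
      exact hf.lt_head _ _ (by simp; omega)
    · rw [hpart _ hi, hlen i (by omega), ← colSel_eq_rowSel S ⟨#S - (i + 1), by omega⟩ _
        (by simp; omega)]
      exact hf.head_le _
  refine ⟨A, ⟨hdpp, fun i hi m hm => ?_⟩, ?_, ?_⟩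
  · rw [hpart i hi]
    rw [rowLen, hget i hi] at hm
    exact (hanti _ m hm).trans ((hf.head_le _).trans (by have := (colSel S ⟨#S - i, by omega⟩).2; omega))
  · ext s
    simp only [lenSet, mem_filter, mem_univ, true_and]
    have hr := mem_range_rowSel S s.succ
    simp only [mem_insert, Fin.succ_ne_zero, mem_map, false_or, Fin.coe_succEmb, Fin.succ_inj,
      exists_eq_right] at hr
    rw [← hr]
    constructor
    · rintro ⟨i, hi, h⟩
      rw [hlen i hi] at h
      exact ⟨_, Fin.ext (by simpa using h)⟩
    · rintro ⟨a, ha⟩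
      have ha0 : a.1 ≠ 0 := by
        intro h
        obtain rfl : a = 0 := Fin.ext h
        rw [rowSel_zero] at ha
        exact (Fin.succ_ne_zero s) ha.symm
      have ha2 := a.2
      refine ⟨#S - a.1, by omega, ?_⟩
      rw [hlen _ (by omega)]
      have e : (⟨#S - (#S - a.1), by omega⟩ : Fin (#S + 1)) = a := Fin.ext (by simp; omega)
      rw [e, ha, Fin.val_succ]
  · ext1 a
    have ha2 := a.2
    rcases Nat.eq_zero_or_pos a.1 with h | h
    · obtain rfl : a = 0 := Fin.ext h
      have h0 := hf.len 0
      rw [rowSel_zero] at h0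
      have h1 : f 0 = [] := List.length_eq_zero_iff.1 (by simpa using h0)
      rw [h1, bottomFirst, List.getD_eq_default _ _ (by simp [hl])]
    · rw [bottomFirst, hget _ (by omega)]
      congr 1
      ext
      simp
      omega

theorem bottomFirst_injOn (r : ℕ) : Set.InjOn (bottomFirst r) {A | A.length = r} := by
  intro A hA B hB h
  simp only [Set.mem_ofPred_eq] at hA hB
  refine List.ext_getElem (by omega) fun i h1 h2 => ?_
  have := congrFun h ⟨r - i, by omega⟩
  simp only [bottomFirst] at this
  rw [show r - (r - i) = i by omega, List.getD_eq_getElem _ _ h1, List.getD_eq_getElem _ _ h2] at this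
  exact this

variable {K : Type*} [Field K] (x y z : K)

theorem dppWeight_eq_prod {n : ℕ} {A : List (List ℕ)} (hA : IsDPP A) (hn : HasOrder n A) :
    dppWeight x y z n A = ∏ i ∈ range A.length, rowWeight x y z n 0 (A.getD i []) := by
  simp only [dppWeight, numSpecial, numNonspecial, numMax, ← prod_pow_eq_pow_sum,
    ← prod_mul_distrib]
  refine prod_congr rfl fun i hi => ?_
  rw [mem_range] at hi
  have hpow : ∀ (c : K) (P : ℕ → Prop) [DecidablePred P],
      c ^ #((range (rowLen A i)).filter P) = ∏ t ∈ range (rowLen A i), if P t then c else 1 := by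
    intro c P _
    rw [prod_ite]
    simp
  rw [hpow, hpow, hpow, ← prod_mul_distrib, ← prod_mul_distrib, rowWeight]
  refine prod_congr rfl fun t ht => ?_
  rw [mem_range] at ht
  have h1 : (A.getD i []).length < n := rowLen_lt_order hA hn hi
  rw [zero_add, stepWeight]
  change _ = if part A i t = n then y * z else if part A i t ≤ t then x else y
  -- A part equal to n is never special, since its position is less than the row length, which is
  -- less than n; hence its weight is yz.
  by_cases h : part A i t = n
  · rw [if_pos h, if_pos h, if_neg (by omega), if_pos (by omega), one_mul]
  · rw [if_neg h, if_neg h, mul_one]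
    split_ifs <;> simp

theorem prod_bottomFirst {A : List (List ℕ)} (n : ℕ) :
    ∏ a, rowWeight x y z n 0 (bottomFirst A.length A a) =
      ∏ i ∈ range A.length, rowWeight x y z n 0 (A.getD i []) := by
  have h0 : bottomFirst A.length A 0 = [] := by simp [bottomFirst]
  rw [Fin.prod_univ_succ, h0, rowWeight_nil, one_mul, ← prod_range_reflect, Finset.prod_range]
  refine prod_congr rfl fun a _ => ?_
  have := a.2
  rw [bottomFirst]
  congr 2
  simp
  omega

/-- The determinant formula for descending plane partitions. -/
theorem dppZ_eq_det (N : ℕ) : dppZ (N + 1) x y z = (Matrix.of fun l m : Fin (N + 1) =>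
    PowerSeries.coeff l (pathSeries x y z (N + 1) 0 (m.1 + 1)) -
      if l.1 = m.1 + 1 then 1 else 0).det := by
  rw [det_sub_shift (fun l m : Fin (N + 1) =>
    PowerSeries.coeff l (pathSeries x y z (N + 1) 0 (m.1 + 1))), dppZ,
    ← sum_fiberwise_of_maps_to (g := lenSet N) (t := univ) (fun _ _ => mem_univ _)]
  refine sum_congr rfl fun S _ => ?_
  have hmem : ∀ A, A ∈ (finite_dpp (N + 1)).toFinset.filter (fun A => lenSet N A = S) ↔
      (IsDPP A ∧ HasOrder (N + 1) A) ∧ lenSet N A = S := by simp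
  have hlen : ∀ A, A ∈ (finite_dpp (N + 1)).toFinset.filter (fun A => lenSet N A = S) →
      A.length = #S := fun A hA => by
    rw [hmem] at hA
    rw [← hA.2, card_lenSet hA.1.1 hA.1.2]
  have key := sum_rowWeight_eq_det x y z (n := N + 1) (N + 1) 0 (fun a => (rowSel S a).1)
    (fun a => (colSel S a).1 + 1) (fun a b h => rowSel_strictMono S h)
    (fun a b h => Nat.succ_lt_succ (colSel_strictMono S h)) (fun a => (colSel S a).2)
    (fun a => (rowSel S a).2) (fun a => Nat.zero_le _) (fun a => by simpa using (rowSel S a).2)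
    (((finite_dpp (N + 1)).toFinset.filter (fun A => lenSet N A = S)).image (bottomFirst #S))
    (fun f => by
      rw [mem_image]
      constructor
      · rintro ⟨A, hA, rfl⟩
        rw [hmem] at hA
        exact isArray_bottomFirst hA.1.1 hA.1.2 hA.2
      · intro hf
        obtain ⟨A, h1, h2, h3⟩ := exists_dpp_of_isArray hf
        exact ⟨A, (hmem A).2 ⟨h1, h2⟩, h3⟩)
  rw [sum_image fun A hA B hB h => bottomFirst_injOn #S (hlen A hA) (hlen B hB) h] at key
  refine Eq.trans (sum_congr rfl fun A hA => ?_) key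
  have h1 := hlen A hA
  rw [hmem] at hA
  rw [dppWeight_eq_prod x y z hA.1.1 hA.1.2, ← h1, prod_bottomFirst]

end DPP

/-! ### Comparison -/

section Main

theorem map_asmZ {A B : Type*} [CommRing A] [CommRing B] (f : A →+* B) (n : ℕ) (x y z : A) :
    f (asmZ n x y z) = asmZ n (f x) (f y) (f z) := by
  simp [asmZ, asmWeight]

theorem map_dppZ {A B : Type*} [CommRing A] [CommRing B] (f : A →+* B) (n : ℕ) (x y z : A) :
    f (dppZ n x y z) = dppZ n (f x) (f y) (f z) := by
  simp [dppZ, dppWeight]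

theorem asmZ_eq_dppZ_of_field {K : Type*} [Field K] (x y : K) {z : K} (hz : z ≠ 0) (N : ℕ) :
    asmZ (N + 1) x y z = dppZ (N + 1) x y z := by
  rw [asmZ_eq_det x y hz, dppZ_eq_det, ← Matrix.det_transpose]
  rfl

theorem asmZ_zero {R : Type*} [CommRing R] (x y z : R) : asmZ 0 x y z = 1 := by
  have h : (finite_asm 0).toFinset = {0} := by
    ext B
    simp only [Set.Finite.mem_toFinset, Set.mem_ofPred_eq, mem_singleton]
    refine ⟨fun _ => Subsingleton.elim _ _, fun _ => ⟨?_, ?_, ?_, ?_, ?_⟩⟩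
    · exact fun i => i.elim0
    · exact fun i => i.elim0
    · exact fun i => i.elim0
    · exact fun i => i.elim0
    · exact fun i => i.elim0
  rw [asmZ, h, sum_singleton]
  simp [asmWeight, topZeros, inv, numNeg]

theorem dppZ_zero {R : Type*} [CommRing R] (x y z : R) : dppZ 0 x y z = 1 := by
  have h : (finite_dpp 0).toFinset = {[]} := by
    ext A
    simp only [Set.Finite.mem_toFinset, Set.mem_ofPred_eq, mem_singleton]
    constructor
    · rintro ⟨hA, hn⟩
      by_contra hne
      have h1 : 0 < A.length := List.length_pos_iff.2 hne
      have h2 := rowLen_lt_order hA hn h1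
      omega
    · rintro rfl
      exact ⟨⟨by simp, by simp, by simp, by simp, by simp, by simp, by simp⟩, by simp [HasOrder]⟩
  rw [dppZ, h, sum_singleton]
  simp [dppWeight, numSpecial, numNonspecial, numMax]

end Main

end ASMDPP

theorem theorem1 {R : Type*} [CommRing R] (n : ℕ) (x y z : R) :
    ASMDPP.asmZ n x y z = ASMDPP.dppZ n x y z := by
  cases n with
  | zero => rw [ASMDPP.asmZ_zero, ASMDPP.dppZ_zero]
  | succ N =>
    have hι := IsFractionRing.injective (MvPolynomial (Fin 3) ℤ)
      (FractionRing (MvPolynomial (Fin 3) ℤ))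
    have h : ASMDPP.asmZ (N + 1) (MvPolynomial.X 0 : MvPolynomial (Fin 3) ℤ) (.X 1) (.X 2) =
        ASMDPP.dppZ (N + 1) (.X 0) (.X 1) (.X 2) := by
      apply hι
      rw [ASMDPP.map_asmZ, ASMDPP.map_dppZ]
      refine ASMDPP.asmZ_eq_dppZ_of_field _ _ ?_ N
      -- The field formula needs z ≠ 0, which holds for a variable; z = 0 is reached only by the
      -- later specialization.
      rw [ne_eq, map_eq_zero_iff _ hι]
      exact MvPolynomial.X_ne_zero 2
    have h2 := congrArg (MvPolynomial.eval₂Hom (Int.castRingHom R) ![x, y, z]) h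
    rw [ASMDPP.map_asmZ, ASMDPP.map_dppZ] at h2
    simpa using h2
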